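/- **Theorem 1.13** (Spatial Littlewood–Paley–Stein inequalities for the heat semigroup). Notation. Let $(Y,\|\cdot\|_Y)$ be a (real) Banach space and $q\in[2,\infty)$. * $Y$ *admits an equivalent norm with modulus of uniform convexity of power type $q$* if there are a norm $|||\cdot|||$ on $Y$ and constants $a,b,C\in(0,\infty)$ such that $a\|y\|_Y\le |||y|||\le b\|y\|_Y$ for all $y\in Y$, and $|||x+y|||\le 2-C^{-q}|||x-y|||^q$ for all $x,y\in Y$ with $|||x|||,|||y|||\le 1$. * The *martingale cotype $q$ constant* $\mathfrak m_q(Y)$ is the supremum of $\big(\sum_{k=1}^\infty\int\|M_{k+1}-M_k\|_Y^q\,d\mu\big)^{1/q}$ over all $Y$-valued martingales $\{M_k\}_{k=1}^\infty$ on probability spaces $(\mathscr S,\mathscr F,\mu)$ with $\sup_{k}\int\|M_k\|_Y^q\,d\mu=1$ (and $0$ if there are none, i.e. if $Y=\{0\}$). * For $t>0$ and $f\in L_q(\mathbb R^n;Y)$, the heat evolute is $H_tf(x)=\int_{\mathbb R^n}h_t(z)f(x-z)\,dz$, where $h_t(x)=(4\pi t)^{-n/2}e^{-|x|^2/(4t)}$;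 $(z\cdot\nabla)g$ denotes the directional derivative of $g$ in direction $z$, and $\partial_j=e_j\cdot\nabla$. For $\vec f=(f_1,\dots,f_n)$ put $\operatorname{div}H_t\vec f=\sum_{j=1}^n\partial_j(H_tf_j)$ and $\sigma\cdot\vec f=\sum_{j=1}^n\sigma_jf_j$. * $S^{n-1}$ is the Euclidean unit sphere of $\mathbb R^n$, $d\sigma$ denotes its surface measure, and $|S^{n-1}|$ its total surface measure. Statement. There is a universal constant $c\in(0,\infty)$ with the following property. Let $q\in[2,\infty)$ and $n\in\{1,2,\dots\}$, and let $Y$ be a Banach space that admits an equivalent norm with modulus of uniform convexity of power type $q$. Then: 1. For all $\vec f=(f_1,\dots,f_n)$ with $f_1,\dots,f_n\in L_q(\mathbb R^n;Y)$, the functions $H_tf_j$ are differentiable on $\mathbb R^n$ for every $t>0$, and $$\Big(\int_0^\infty\big\|\sqrt t\,\operatorname{div}H_t\vec f\,\big\|_{L_q(\mathbb R^n;Y)}^q\frac{dt}{t}\Big)^{1/q}\le c\,\sqrt n\;\mathfrak m_q(Y)\,\frac{1}{|S^{n-1}|}\int_{S^{n-1}}\big\|\sigma\cdot\vec f\,\big\|_{L_q(\mathbb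 R^n;Y)}\,d\sigma .$$ 2. For all $f\in L_q(\mathbb R^n;Y)$ and $z\in\mathbb R^n$, the function $H_tf$ is differentiable on $\mathbb R^n$ for every $t>0$, and $$\Big(\int_0^\infty\big\|\sqrt t\,(z\cdot\nabla)H_tf\big\|_{L_q(\mathbb R^n;Y)}^q\frac{dt}{t}\Big)^{1/q}\le c\,|z|\,\mathfrak m_q(Y)\,\|f\|_{L_q(\mathbb R^n;Y)} .$$ -/

import Mathlib

open MeasureTheory
open scoped ENNReal NNReal

namespace HeatLPS

/-- `Y` admits an equivalent norm whose modulus of uniform convexity has power type `q`: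
there are a norm `N` on `Y` with `a ‖y‖ ≤ N y ≤ b ‖y‖` and a constant `C` such that
`N (x + y) ≤ 2 - C ^ (-q) * N (x - y) ^ q` whenever `N x ≤ 1` and `N y ≤ 1`. -/
def HasPowerTypeRenorming (q : ℝ) (Y : Type*) [NormedAddCommGroup Y] [NormedSpace ℝ Y] : Prop :=
  ∃ (N : Seminorm ℝ Y) (a b C : ℝ), 0 < a ∧ 0 < b ∧ 0 < C ∧
    (∀ y, a * ‖y‖ ≤ N y ∧ N y ≤ b * ‖y‖) ∧
    ∀ x y, N x ≤ 1 → N y ≤ 1 → N (x + y) ≤ 2 - 1 / C ^ q * N (x - y) ^ q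

/-- The martingale cotype `q` constant of `Y`, in `[0, ∞]`: the supremum of
`(∑ₖ ∫ ‖Mₖ₊₁ - Mₖ‖ ^ q dμ) ^ (1 / q)` over all probability spaces and all `Y`-valued martingales
`M` on them with `supₖ ∫ ‖Mₖ‖ ^ q dμ = 1`. (Probability spaces in `Type` suffice: only the joint
law of the sequence `M` matters, and it lives on the countable power of a separable closed subspace
of `Y`, a Polish space, hence Borel isomorphic to a Borel subset of `ℝ`.) -/
noncomputable def martingaleCotypeConst (q : ℝ) (Y : Type*) [NormedAddCommGroup Y]
    [NormedSpace ℝ Y] [CompleteSpace Y] : ℝ≥0∞ :=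
  ⨆ (Ω : Type) (mΩ : MeasurableSpace Ω) (μ : Measure Ω) (_ : IsProbabilityMeasure μ)
    (ℱ : Filtration ℕ mΩ) (M : ℕ → Ω → Y) (_ : Martingale M ℱ μ)
    (_ : (⨆ k, ∫⁻ ω, ‖M k ω‖ₑ ^ q ∂μ) = 1),
    (∑' k, ∫⁻ ω, ‖M (k + 1) ω - M k ω‖ₑ ^ q ∂μ) ^ (1 / q)

/-- The heat kernel `h_t(x) = (4πt)^{-n/2} exp(-|x|² / (4t))` on `ℝⁿ`. -/
noncomputable def heatKernel {n : ℕ} (t : ℝ) (x : EuclideanSpace ℝ (Fin n)) : ℝ :=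
  1 / (4 * Real.pi * t) ^ ((n : ℝ) / 2) * Real.exp (-‖x‖ ^ 2 / (4 * t))

variable {n : ℕ} {Y : Type*} [NormedAddCommGroup Y] [NormedSpace ℝ Y]

/-- The heat semigroup, `H_t f(x) = ∫ h_t(z) f(x - z) dz`. -/
noncomputable def heat (t : ℝ) (f : EuclideanSpace ℝ (Fin n) → Y) :
    EuclideanSpace ℝ (Fin n) → Y :=
  fun x => ∫ z, heatKernel t z • f (x - z)

/-- The divergence `∑ⱼ ∂ⱼ gⱼ` of a tuple of `Y`-valued functions on `ℝⁿ`. -/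
noncomputable def divergence (g : Fin n → EuclideanSpace ℝ (Fin n) → Y) :
    EuclideanSpace ℝ (Fin n) → Y :=
  fun x => ∑ j, lineDeriv ℝ (g j) x (EuclideanSpace.single j 1)

end HeatLPS

/-! Martingale cotype controls differences of the heat semigroup, and spatial derivatives are
Gaussian averages of such differences.

Fix `f` and `T`. A random walk whose increment from time `k` to `k + 1` has the law of the heat
kernel at time `T / 2 ^ (k + 1)` turns the functions `H_{T/2^k} f` into a martingale, because `T / 2
^ (k + 1)` added to itself is `T / 2 ^ k`. Starting the walk uniformly on large balls replaces
Lebesgue measure by probability measures, and the volume of the ball cancels from the cotype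
inequality. With `u = T / 2 ^ (k + 1)`, an increment compares `H_u f` at the endpoint with `H_{2u}
f` at the previous position. Averaging over the previous position with the endpoint fixed turns
`H_{2u} f` into `H_{3u} f`, so the increment dominates `‖H_u f - H_{3u} f‖_q`
(`tsum_eLpNorm_heat_sub_heat_le`). Averaging over `T` gives the bound in `dt / t`.

Let `D_t = ∑ⱼ ∂_{vⱼ} H_t fⱼ`. Differentiating the Gaussian gives `‖D_t‖_q ≤ (2√t)⁻¹ ∫ ‖∑ⱼ ⟪w, vⱼ⟫
fⱼ‖_q dγ(w)`, where `γ` is the heat measure at time 1. Applied at time `a` to `H_a fⱼ - H_{3a} fⱼ`,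
this estimates `D_{2a} - D_{4a}`. Telescoping over `a = 2 ^ k t / 2` expresses `√t D_t` through
semigroup differences with geometrically decaying weights. Minkowski's inequality and the scale
invariance of `dt / t` then reduce everything to the difference bound for the single functions `∑ⱼ
⟪w, vⱼ⟫ fⱼ`, with `w` fixed (`lintegral_sqrt_smul_heatDeriv_le`).

What remains is a Gaussian average of a function of `w` homogeneous of degree one. For the
divergence, polar coordinates make it a spherical average times `∫ ‖w‖ dγ`, of order `√n`; for one
direction `z` it is `∫ |⟪w, z⟫| dγ`, bounded by a universal multiple of `‖z‖`. -/

namespace HeatLPS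

/-! ### The Gaussian measure: semigroup law, scaling and moments -/

section HeatMeasure

variable {n : ℕ}

lemma heatKernel_nonneg {t : ℝ} (ht : 0 ≤ t) (x : EuclideanSpace ℝ (Fin n)) :
    0 ≤ heatKernel t x := by
  unfold heatKernel
  have := Real.pi_pos
  positivity

lemma measurable_heatKernel_uncurry :
    Measurable fun p : ℝ × EuclideanSpace ℝ (Fin n) => heatKernel p.1 p.2 := by
  unfold heatKernel
  fun_prop

lemma measurable_heatKernel (t : ℝ) :
    Measurable (heatKernel t : EuclideanSpace ℝ (Fin n) → ℝ) :=
  measurable_heatKernel_uncurry.comp measurable_prodMk_left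

lemma heatKernel_le {t : ℝ} (ht : 0 ≤ t) (x : EuclideanSpace ℝ (Fin n)) :
    heatKernel t x ≤ 1 / (4 * Real.pi * t) ^ ((n : ℝ) / 2) := by
  unfold heatKernel
  have := Real.pi_pos
  refine mul_le_of_le_one_right (by positivity) ?_
  rw [Real.exp_le_one_iff, neg_div]
  have : 0 ≤ ‖x‖ ^ 2 / (4 * t) := by positivity
  linarith

/-- The measure on `ℝⁿ` with density the heat kernel at time `t`. -/
noncomputable def heatMeasure (n : ℕ) (t : ℝ) : Measure (EuclideanSpace ℝ (Fin n)) :=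
  volume.withDensity fun x => ENNReal.ofReal (heatKernel t x)

lemma heatMeasure_le_smul {t : ℝ} (ht : 0 ≤ t) :
    heatMeasure n t ≤ ENNReal.ofReal (1 / (4 * Real.pi * t) ^ ((n : ℝ) / 2)) • volume := by
  rw [← withDensity_const]
  exact withDensity_mono (.of_forall fun x => ENNReal.ofReal_le_ofReal (heatKernel_le ht x))

lemma integral_heatMeasure {F : Type*} [NormedAddCommGroup F] [NormedSpace ℝ F] {t : ℝ}
    (ht : 0 ≤ t) (g : EuclideanSpace ℝ (Fin n) → F) :
    ∫ w, g w ∂heatMeasure n t = ∫ w, heatKernel t w • g w := by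
  rw [heatMeasure, integral_withDensity_eq_integral_toReal_smul
    (measurable_heatKernel t).ennreal_ofReal (by simp)]
  simp_rw [ENNReal.toReal_ofReal (heatKernel_nonneg ht _)]

/-- A complex `c` covers three uses: `c = 0` gives the total mass, `c = I` the characteristic
function, `c = 1` the exponential moments. -/
lemma integral_cexp_heatMeasure {t : ℝ} (ht : 0 < t) (c : ℂ) (v : EuclideanSpace ℝ (Fin n)) :
    ∫ w, Complex.exp (c * (inner ℝ v w : ℝ)) ∂heatMeasure n t
      = Complex.exp (c ^ 2 * t * ‖v‖ ^ 2) := by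
  rw [integral_heatMeasure ht.le]
  have hb : (0 : ℝ) < (1 / (4 * t) : ℂ).re := by
    have : (1 / (4 * t) : ℂ) = ((1 / (4 * t) : ℝ) : ℂ) := by push_cast; rfl
    rw [this, Complex.ofReal_re]; positivity
  have key := GaussianFourier.integral_cexp_neg_mul_sq_norm_add hb c v
  have hpos : (0 : ℝ) < 4 * Real.pi * t := by have := Real.pi_pos; positivity
  have h1 : ∀ w : EuclideanSpace ℝ (Fin n),
      heatKernel t w • Complex.exp (c * (inner ℝ v w : ℝ)) =
        ((1 / (4 * Real.pi * t) ^ ((n : ℝ) / 2) : ℝ) : ℂ) *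
          Complex.exp (-(1 / (4 * t) : ℂ) * ‖w‖ ^ 2 + c * (inner ℝ v w : ℝ)) := by
    intro w
    rw [heatKernel, Complex.exp_add, Complex.real_smul, Complex.ofReal_mul, mul_assoc]
    congr 2
    push_cast
    congr 1
    ring
  simp_rw [h1]
  rw [integral_const_mul, key, finrank_euclideanSpace_fin, ← mul_assoc]
  have h2 : (Real.pi / (1 / (4 * t)) : ℂ) = ((4 * Real.pi * t : ℝ) : ℂ) := by
    have : (t : ℂ) ≠ 0 := by exact_mod_cast ht.ne'
    push_cast; field_simp
  have h3 : ((n : ℂ) / 2) = (((n : ℝ) / 2 : ℝ) : ℂ) := by push_cast; rfl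
  rw [h2, h3, ← Complex.ofReal_cpow hpos.le, ← Complex.ofReal_mul,
    one_div_mul_cancel (Real.rpow_pos_of_pos hpos _).ne', Complex.ofReal_one, one_mul]
  congr 1
  have : (t : ℂ) ≠ 0 := by exact_mod_cast ht.ne'
  field_simp

lemma isProbabilityMeasure_heatMeasure {t : ℝ} (ht : 0 < t) :
    IsProbabilityMeasure (heatMeasure n t) := by
  have h := integral_cexp_heatMeasure (n := n) ht 0 0
  simp only [zero_mul, Complex.exp_zero, ne_eq, OfNat.ofNat_ne_zero, not_false_eq_true,
    zero_pow, integral_const, Complex.real_smul, mul_one] at h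
  have h' : (heatMeasure n t).real Set.univ = 1 := by exact_mod_cast h
  refine ⟨?_⟩
  rw [Measure.real, ENNReal.toReal_eq_one_iff] at h'
  exact h'

lemma charFun_heatMeasure {t : ℝ} (ht : 0 < t) (v : EuclideanSpace ℝ (Fin n)) :
    charFun (heatMeasure n t) v = Complex.exp (-(t * ‖v‖ ^ 2 : ℝ)) := by
  rw [charFun_apply]
  have := integral_cexp_heatMeasure ht Complex.I v
  simp_rw [real_inner_comm v, mul_comm _ Complex.I]
  rw [this, Complex.I_sq]
  push_cast
  congr 1
  ring

lemma heatMeasure_conv {s t : ℝ} (hs : 0 < s) (ht : 0 < t) :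
    (heatMeasure n s).conv (heatMeasure n t) = heatMeasure n (s + t) := by
  have := isProbabilityMeasure_heatMeasure (n := n) hs
  have := isProbabilityMeasure_heatMeasure (n := n) ht
  have := isProbabilityMeasure_heatMeasure (n := n) (add_pos hs ht)
  refine Measure.ext_of_charFun (funext fun v => ?_)
  rw [charFun_conv, charFun_heatMeasure hs, charFun_heatMeasure ht,
    charFun_heatMeasure (add_pos hs ht), ← Complex.exp_add]
  congr 1
  push_cast
  ring

lemma map_smul_heatMeasure {t r : ℝ} (ht : 0 < t) (hr : r ≠ 0) :
    (heatMeasure n t).map (fun w => r • w) = heatMeasure n (r ^ 2 * t) := by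
  have := isProbabilityMeasure_heatMeasure (n := n) ht
  have hr2 : 0 < r ^ 2 * t := by positivity
  have := isProbabilityMeasure_heatMeasure (n := n) hr2
  have : IsProbabilityMeasure ((heatMeasure n t).map (fun w => r • w)) :=
    Measure.isProbabilityMeasure_map (by fun_prop)
  refine Measure.ext_of_charFun (funext fun v => ?_)
  rw [charFun_map_smul, charFun_heatMeasure ht, charFun_heatMeasure hr2, norm_smul,
    mul_pow, Real.norm_eq_abs, sq_abs]
  congr 3
  ring

lemma map_neg_heatMeasure {t : ℝ} (ht : 0 < t) :
    (heatMeasure n t).map (fun w => -w) = heatMeasure n t := by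
  simpa using map_smul_heatMeasure (n := n) ht (neg_ne_zero.2 one_ne_zero : (-1 : ℝ) ≠ 0)

lemma lintegral_exp_inner_heatMeasure {t : ℝ} (ht : 0 < t) (v : EuclideanSpace ℝ (Fin n)) :
    ∫⁻ w, ENNReal.ofReal (Real.exp (inner ℝ v w)) ∂heatMeasure n t
      = ENNReal.ofReal (Real.exp (t * ‖v‖ ^ 2)) := by
  have hc := integral_cexp_heatMeasure ht 1 v
  have hi : Integrable (fun w => Real.exp (inner ℝ v w)) (heatMeasure n t) := by
    -- A non-integrable function would have integral `0` by convention, but the formula gives an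
    -- exponential, which never vanishes.
    by_contra hcon
    have h' : ¬ Integrable (fun w => Complex.exp (1 * (inner ℝ v w : ℝ))) (heatMeasure n t) := by
      intro h
      apply hcon
      have := h.re
      refine this.congr (.of_forall fun w => ?_)
      simp only [one_mul]
      rw [← Complex.ofReal_exp]
      exact Complex.ofReal_re _
    rw [integral_undef h'] at hc
    exact Complex.exp_ne_zero _ hc.symm
  rw [← ofReal_integral_eq_lintegral_ofReal hi (.of_forall fun _ => (Real.exp_pos _).le)]
  congr 1
  have : ((∫ w, Real.exp (inner ℝ v w) ∂heatMeasure n t : ℝ) : ℂ)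
      = (Real.exp (t * ‖v‖ ^ 2) : ℝ) := by
    rw [← integral_complex_ofReal]
    push_cast
    simpa using hc
  exact_mod_cast this

/-- The pointwise bound `s² ≤ 2(eˢ + e⁻ˢ)` reduces this to exponential moments and yields `4e < 12`;
only independence of `n` matters. -/
lemma lintegral_inner_sq_heatMeasure_le (v : EuclideanSpace ℝ (Fin n)) (hv : ‖v‖ = 1) :
    ∫⁻ w, ENNReal.ofReal (inner ℝ v w ^ 2) ∂heatMeasure n 1 ≤ 12 := by
  have hpt : ∀ s : ℝ, s ^ 2 ≤ 2 * (Real.exp s + Real.exp (-s)) := by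
    intro s
    rcases le_total 0 s with h | h
    · have := Real.quadratic_le_exp_of_nonneg h
      have := Real.exp_pos (-s)
      linarith
    · have := Real.quadratic_le_exp_of_nonneg (neg_nonneg.2 h)
      have := Real.exp_pos s
      nlinarith
  calc ∫⁻ w, ENNReal.ofReal (inner ℝ v w ^ 2) ∂heatMeasure n 1
      ≤ ∫⁻ w, 2 * (ENNReal.ofReal (Real.exp (inner ℝ v w))
          + ENNReal.ofReal (Real.exp (inner ℝ (-v) w))) ∂heatMeasure n 1 := by
        refine lintegral_mono fun w => ?_
        rw [← ENNReal.ofReal_add (Real.exp_pos _).le (Real.exp_pos _).le, inner_neg_left]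
        have h2 : ∀ x, 2 * ENNReal.ofReal x = ENNReal.ofReal (2 * x) := fun x => by
          rw [ENNReal.ofReal_mul two_pos.le, ENNReal.ofReal_ofNat]
        rw [h2]
        exact ENNReal.ofReal_le_ofReal (hpt _)
    _ = 2 * (ENNReal.ofReal (Real.exp 1) + ENNReal.ofReal (Real.exp 1)) := by
        rw [lintegral_const_mul _ (by fun_prop),
          lintegral_add_left (by fun_prop), lintegral_exp_inner_heatMeasure one_pos,
          lintegral_exp_inner_heatMeasure one_pos]
        simp [hv]
    _ ≤ 12 := by
        rw [← ENNReal.ofReal_add (Real.exp_pos _).le (Real.exp_pos _).le,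
          ← ENNReal.ofReal_ofNat, ← ENNReal.ofReal_ofNat, ← ENNReal.ofReal_mul (by norm_num)]
        refine ENNReal.ofReal_le_ofReal ?_
        have := Real.exp_one_lt_three
        linarith

lemma lintegral_enorm_inner_heatMeasure_le (z : EuclideanSpace ℝ (Fin n)) :
    ∫⁻ w, ‖(inner ℝ w z : ℝ)‖ₑ ∂heatMeasure n 1 ≤ 7 * ‖z‖ₑ := by
  rcases eq_or_ne z 0 with rfl | hz
  · simp
  have := isProbabilityMeasure_heatMeasure (n := n) one_pos
  set v := ‖z‖⁻¹ • z with hv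
  have hz' : ‖z‖ ≠ 0 := norm_ne_zero_iff.2 hz
  have hv1 : ‖v‖ = 1 := by rw [hv, norm_smul, norm_inv, norm_norm, inv_mul_cancel₀ hz']
  have hzv : z = ‖z‖ • v := by rw [hv, smul_smul, mul_inv_cancel₀ hz', one_smul]
  calc ∫⁻ w, ‖(inner ℝ w z : ℝ)‖ₑ ∂heatMeasure n 1
      ≤ ∫⁻ w, ‖z‖ₑ * ENNReal.ofReal ((1 + inner ℝ v w ^ 2) / 2) ∂heatMeasure n 1 := by
        refine lintegral_mono fun w => ?_
        conv_lhs => rw [hzv, inner_smul_right, enorm_mul, enorm_norm]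
        gcongr
        rw [Real.enorm_eq_ofReal_abs, real_inner_comm]
        refine ENNReal.ofReal_le_ofReal ?_
        nlinarith [sq_nonneg (|(inner ℝ v w : ℝ)| - 1), sq_abs (inner ℝ v w : ℝ)]
    _ ≤ ‖z‖ₑ * ∫⁻ w, (1 + ENNReal.ofReal (inner ℝ v w ^ 2)) / 2 ∂heatMeasure n 1 := by
        rw [lintegral_const_mul _ (by fun_prop)]
        gcongr with w
        rw [ENNReal.ofReal_div_of_pos two_pos, ENNReal.ofReal_add zero_le_one (sq_nonneg _)]
        simp
    _ ≤ ‖z‖ₑ * ((1 + 12) / 2) := by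
        simp_rw [div_eq_mul_inv]
        rw [lintegral_mul_const _ (by fun_prop), lintegral_add_left (by fun_prop)]
        gcongr
        · simp
        · exact lintegral_inner_sq_heatMeasure_le v hv1
    _ ≤ 7 * ‖z‖ₑ := by
        rw [mul_comm]
        gcongr
        rw [ENNReal.div_le_iff (by simp) (by simp)]
        norm_num

lemma lintegral_enorm_heatMeasure_le :
    ∫⁻ w, ‖w‖ₑ ∂heatMeasure n 1 ≤ 13 * ENNReal.ofReal √(n : ℝ) := by
  have := isProbabilityMeasure_heatMeasure (n := n) one_pos
  rcases Nat.eq_zero_or_pos n with rfl | hn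
  · simp [Subsingleton.elim _ (0 : EuclideanSpace ℝ (Fin 0))]
  have hn0 : (0 : ℝ) < n := by exact_mod_cast hn
  have hs : 0 < √(n : ℝ) := Real.sqrt_pos.2 hn0
  calc ∫⁻ w, ‖w‖ₑ ∂heatMeasure n 1
      ≤ ∫⁻ w, ENNReal.ofReal √(n : ℝ) + ENNReal.ofReal (1 / √(n : ℝ)) *
          ∑ j, ENNReal.ofReal (inner ℝ (EuclideanSpace.single j (1 : ℝ)) w ^ 2)
            ∂heatMeasure n 1 := by
        refine lintegral_mono fun w => ?_
        rw [← ENNReal.ofReal_sum_of_nonneg (fun _ _ => sq_nonneg _),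
          ← ENNReal.ofReal_mul (by positivity), ← ENNReal.ofReal_add hs.le (by positivity),
          ← ofReal_norm]
        refine ENNReal.ofReal_le_ofReal ?_
        -- The pointwise bound is `‖w‖ ≤ √n + ‖w‖² / √n`; with `n` coordinates of second moment at
        -- most 12 it integrates to `13√n`.
        have h1 : ∑ j, (inner ℝ (EuclideanSpace.single j (1 : ℝ)) w : ℝ) ^ 2 = ‖w‖ ^ 2 := by
          rw [EuclideanSpace.norm_sq_eq]
          simp [EuclideanSpace.inner_single_left]
        rw [h1, ← sub_nonneg]
        have h2 : √(n : ℝ) + 1 / √(n : ℝ) * ‖w‖ ^ 2 - ‖w‖ =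
            ((√(n : ℝ) - ‖w‖ / 2) ^ 2 + 3 / 4 * ‖w‖ ^ 2) / √(n : ℝ) := by
          field_simp; ring
        rw [h2]; positivity
    _ ≤ ENNReal.ofReal √(n : ℝ) + ENNReal.ofReal (1 / √(n : ℝ)) * ∑ j : Fin n, 12 := by
        rw [lintegral_add_left (by fun_prop), lintegral_const_mul _ (by fun_prop),
          lintegral_finsetSum _ (by fun_prop)]
        gcongr
        · simp
        · exact lintegral_inner_sq_heatMeasure_le _ (by simp)
    _ ≤ 13 * ENNReal.ofReal √(n : ℝ) := by
        have h12 : (12 : ℝ≥0∞) = ENNReal.ofReal 12 := by norm_num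
        have h13 : (13 : ℝ≥0∞) = ENNReal.ofReal 13 := by norm_num
        rw [Finset.sum_const, Finset.card_univ, Fintype.card_fin, nsmul_eq_mul, h12, h13,
          ← ENNReal.ofReal_natCast, ← ENNReal.ofReal_mul (by positivity),
          ← ENNReal.ofReal_mul (by positivity), ← ENNReal.ofReal_add hs.le (by positivity),
          ← ENNReal.ofReal_mul (by positivity)]
        refine ENNReal.ofReal_le_ofReal (le_of_eq ?_)
        have := Real.sq_sqrt hn0.le
        field_simp
        rw [this]
        ring

end HeatMeasure

/-! ### Minkowski's integral inequality -/

section Minkowski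

variable {α β : Type*} [MeasurableSpace α] [MeasurableSpace β] {μ : Measure α} {ν : Measure β}

/-- Duality: with `F = ∫ g dν`, bound `∫ F · F ^ (p - 1)` by Tonelli and Hölder, then divide by a
power of `∫ F ^ p`. The division needs a finite integral, so the second factor is truncated to `min
F m` on sets of finite measure, and monotone convergence finishes. -/
lemma lintegral_rpow_lintegral_le_of_measurable [SigmaFinite μ] [SFinite ν] {p : ℝ} (hp : 1 < p)
    {g : α → β → ℝ≥0∞} (hg : Measurable (Function.uncurry g)) :
    (∫⁻ x, (∫⁻ y, g x y ∂ν) ^ p ∂μ) ^ (1 / p) ≤ ∫⁻ y, (∫⁻ x, g x y ^ p ∂μ) ^ (1 / p) ∂ν := by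
  have hp0 : 0 < p := one_pos.trans hp
  set B := ∫⁻ y, (∫⁻ x, g x y ^ p ∂μ) ^ (1 / p) ∂ν with hB
  set F : α → ℝ≥0∞ := fun x => ∫⁻ y, g x y ∂ν with hF
  have hFm : Measurable F := hg.lintegral_prod_right
  set G : ℕ → α → ℝ≥0∞ := fun m => (spanningSets μ m).indicator fun x => min (F x) m with hG
  have hGm : ∀ m, Measurable (G m) := fun m =>
    (hFm.min measurable_const).indicator (measurableSet_spanningSets μ m)
  have hGF : ∀ m x, G m x ≤ F x := fun m x => by
    simp only [hG]
    exact (Set.indicator_le_self' (by simp) x).trans (min_le_left _ _)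
  have hmono : Monotone G := by
    intro m k hmk x
    simp only [hG]
    refine (Set.indicator_le_indicator_of_subset (monotone_spanningSets μ hmk) (by simp) x).trans ?_
    refine Set.indicator_le_indicator ?_
    gcongr
  have hsup : ∀ x, ⨆ m, G m x ^ p = F x ^ p := by
    intro x
    refine le_antisymm (iSup_le fun m => by gcongr; exact hGF m x) ?_
    have htend : Filter.Tendsto (fun m : ℕ => min (F x) m ^ p) Filter.atTop (nhds (F x ^ p)) := by
      refine (ENNReal.continuous_rpow_const.tendsto _).comp ?_
      simpa using (tendsto_const_nhds (x := F x)).min ENNReal.tendsto_nat_nhds_top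
    refine le_of_tendsto htend ?_
    filter_upwards [Filter.eventually_ge_atTop (spanningSetsIndex μ x)] with m hm
    refine le_iSup_of_le m ?_
    have : x ∈ spanningSets μ m :=
      monotone_spanningSets μ hm (mem_spanningSetsIndex μ x)
    simp [hG, this]
  have hbound : ∀ m, (∫⁻ x, G m x ^ p ∂μ) ^ (1 / p) ≤ B := by
    intro m
    set A := ∫⁻ x, G m x ^ p ∂μ with hA
    have hAfin : A ≠ ∞ := by
      refine ne_of_lt (lt_of_le_of_lt (b := ∫⁻ x, (spanningSets μ m).indicator
        (fun _ => (m : ℝ≥0∞) ^ p) x ∂μ) (lintegral_mono fun x => ?_) ?_)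
      · by_cases hx : x ∈ spanningSets μ m
        · simp only [hG, Set.indicator_of_mem hx]
          gcongr
          exact min_le_right _ _
        · simp [hG, Set.indicator_of_notMem hx, hp0]
      · rw [lintegral_indicator_const (measurableSet_spanningSets μ m)]
        exact ENNReal.mul_lt_top (ENNReal.rpow_lt_top_of_nonneg hp0.le (by simp))
          (measure_spanningSets_lt_top μ m)
    have hconj : p.HolderConjugate (p / (p - 1)) := Real.HolderConjugate.conjExponent hp
    have h1 : A ≤ B * A ^ (1 / (p / (p - 1))) := by
      calc A ≤ ∫⁻ x, (∫⁻ y, g x y ∂ν) * G m x ^ (p - 1) ∂μ := by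
            refine lintegral_mono fun x => ?_
            have : G m x ^ p = G m x * G m x ^ (p - 1) := by
              conv_rhs => enter [1]; rw [← ENNReal.rpow_one (G m x)]
              rw [← ENNReal.rpow_add_of_nonneg _ _ one_pos.le (by linarith)]
              congr 1; ring
            rw [this]
            gcongr
            exact hGF m x
        _ = ∫⁻ x, ∫⁻ y, g x y * G m x ^ (p - 1) ∂ν ∂μ := by
            refine lintegral_congr fun x => ?_
            exact (lintegral_mul_const _ (hg.comp measurable_prodMk_left)).symm
        _ = ∫⁻ y, ∫⁻ x, g x y * G m x ^ (p - 1) ∂μ ∂ν := by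
            refine lintegral_lintegral_swap (Measurable.aemeasurable ?_)
            exact hg.mul (((hGm m).comp measurable_fst).pow_const _)
        _ ≤ ∫⁻ y, (∫⁻ x, g x y ^ p ∂μ) ^ (1 / p) * A ^ (1 / (p / (p - 1))) ∂ν := by
            refine lintegral_mono fun y => ?_
            exact ENNReal.lintegral_mul_rpow_le_lintegral_rpow_mul_lintegral_rpow hconj
              (hg.comp measurable_prodMk_right).aemeasurable (hGm m).aemeasurable
        _ = B * A ^ (1 / (p / (p - 1))) := by
            rw [lintegral_mul_const]
            exact ((hg.pow_const p).lintegral_prod_left).pow_const _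
    rcases eq_or_ne A 0 with h0 | h0
    · rw [h0, ENNReal.zero_rpow_of_pos (by positivity)]; exact zero_le
    have hA0 : A ^ (1 / (p / (p - 1))) ≠ 0 := by
      simp [ENNReal.rpow_eq_zero_iff, h0, hAfin]
    have hA1 : A ^ (1 / (p / (p - 1))) ≠ ∞ := by
      simp [ENNReal.rpow_eq_top_iff, h0, hAfin]
    rw [← ENNReal.mul_le_mul_iff_left hA0 hA1, ← ENNReal.rpow_add _ _ h0 hAfin]
    have : 1 / p + 1 / (p / (p - 1)) = 1 := by
      have : p - 1 ≠ 0 := by linarith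
      field_simp; ring
    rwa [this, ENNReal.rpow_one]
  calc (∫⁻ x, F x ^ p ∂μ) ^ (1 / p) = (⨆ m, ∫⁻ x, G m x ^ p ∂μ) ^ (1 / p) := by
        rw [← lintegral_iSup (fun m => (hGm m).pow_const p)]
        · simp_rw [hsup]
        · intro m k hmk x
          simp only
          gcongr
          exact hmono hmk x
    _ ≤ (B ^ p) ^ (1 / p) := by
        gcongr
        refine iSup_le fun m => ?_
        rw [← ENNReal.rpow_inv_le_iff hp0, ← one_div]
        exact hbound m
    _ = B := by
        rw [← ENNReal.rpow_mul, mul_one_div_cancel hp0.ne', ENNReal.rpow_one]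

/-- **Minkowski's integral inequality** for nonnegative functions. -/
theorem lintegral_rpow_lintegral_le [SigmaFinite μ] [SFinite ν] {p : ℝ} (hp : 1 < p)
    {g : α → β → ℝ≥0∞} (hg : AEMeasurable (Function.uncurry g) (μ.prod ν)) :
    (∫⁻ x, (∫⁻ y, g x y ∂ν) ^ p ∂μ) ^ (1 / p) ≤ ∫⁻ y, (∫⁻ x, g x y ^ p ∂μ) ^ (1 / p) ∂ν := by
  have h := hg.ae_eq_mk
  have h1 : ∀ᵐ x ∂μ, ∀ᵐ y ∂ν, g x y = hg.mk _ (x, y) := Measure.ae_ae_of_ae_prod h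
  have h2 : ∀ᵐ y ∂ν, ∀ᵐ x ∂μ, g x y = hg.mk _ (x, y) :=
    Measure.ae_ae_of_ae_prod (Measure.measurePreserving_swap.quasiMeasurePreserving.ae h)
  have key := lintegral_rpow_lintegral_le_of_measurable (μ := μ) (ν := ν) hp
    (g := fun x y => hg.mk _ (x, y)) hg.measurable_mk
  convert! key using 1
  · congr 1
    refine lintegral_congr_ae (h1.mono fun x hx => ?_)
    simp only [lintegral_congr_ae hx]
  · refine lintegral_congr_ae (h2.mono fun y hy => ?_)
    simp only
    congr 1
    exact lintegral_congr_ae (hy.mono fun x hx => by simp only [hx])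

/-- Minkowski's inequality for countable sums. -/
theorem lintegral_rpow_tsum_le [SigmaFinite μ] {p : ℝ} (hp : 1 < p)
    {g : ℕ → α → ℝ≥0∞} (hg : ∀ k, Measurable (g k)) :
    (∫⁻ x, (∑' k, g k x) ^ p ∂μ) ^ (1 / p) ≤ ∑' k, (∫⁻ x, g k x ^ p ∂μ) ^ (1 / p) := by
  have := lintegral_rpow_lintegral_le_of_measurable (μ := μ) (ν := Measure.count) hp
    (g := fun x k => g k x) (measurable_from_prod_countable_left hg)
  simpa only [lintegral_count] using this

end Minkowski

/-! ### Integrability of translates against the Gaussian -/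

section Normed

variable {n : ℕ} {Y : Type*} [NormedAddCommGroup Y]

lemma aestronglyMeasurable_comp_sub {f : EuclideanSpace ℝ (Fin n) → Y}
    (hf : AEStronglyMeasurable f) (ν : Measure (EuclideanSpace ℝ (Fin n))) [SFinite ν] :
    AEStronglyMeasurable (fun p : EuclideanSpace ℝ (Fin n) × EuclideanSpace ℝ (Fin n) =>
      f (p.1 - p.2)) (volume.prod ν) :=
  hf.comp_quasiMeasurePreserving
    (quasiMeasurePreserving_sub_of_right_invariant volume ν)

/-- The kernel is bounded, so `L_p` of Lebesgue measure embeds in `L_p`, hence in `L_1`, of the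
Gaussian probability. This holds at every `x`, so later identities are pointwise and not merely
almost everywhere. -/
lemma integrable_translate_heatMeasure {p : ℝ≥0∞} (hp : 1 ≤ p) {t : ℝ} (ht : 0 < t)
    {f : EuclideanSpace ℝ (Fin n) → Y} (hf : MemLp f p) (x : EuclideanSpace ℝ (Fin n)) :
    Integrable (fun w => f (x - w)) (heatMeasure n t) := by
  have := isProbabilityMeasure_heatMeasure (n := n) ht
  have h : MemLp (fun w => f (x - w)) p volume :=
    hf.comp_measurePreserving (Measure.measurePreserving_sub_left volume x)
  exact (h.of_measure_le_smul ENNReal.ofReal_ne_top (heatMeasure_le_smul ht.le)).integrable hp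

lemma integrable_heatKernel_mul_norm {p : ℝ≥0∞} (hp : 1 ≤ p) {t : ℝ} (ht : 0 < t)
    {f : EuclideanSpace ℝ (Fin n) → Y} (hf : MemLp f p) (x : EuclideanSpace ℝ (Fin n)) :
    Integrable (fun y => heatKernel t (x - y) * ‖f y‖) := by
  have h := integrable_translate_heatMeasure hp ht hf.norm x
  rw [heatMeasure, integrable_withDensity_iff_integrable_smul'
    (measurable_heatKernel t).ennreal_ofReal (by simp)] at h
  have h2 := h.comp_sub_left x
  simpa [ENNReal.toReal_ofReal (heatKernel_nonneg ht.le _)] using h2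

end Normed

/-! ### The heat semigroup: algebra, contractivity, differentiability -/

section HeatOperator

variable {n : ℕ} {Y : Type*} [NormedAddCommGroup Y] [NormedSpace ℝ Y]

lemma heat_eq_integral {t : ℝ} (ht : 0 < t) (f : EuclideanSpace ℝ (Fin n) → Y)
    (x : EuclideanSpace ℝ (Fin n)) : heat t f x = ∫ w, f (x - w) ∂heatMeasure n t := by
  rw [integral_heatMeasure ht.le, heat]

lemma heat_heat {p : ℝ≥0∞} (hp : 1 ≤ p) {s t : ℝ} (hs : 0 < s) (ht : 0 < t)
    {f : EuclideanSpace ℝ (Fin n) → Y} (hf : MemLp f p) :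
    heat s (heat t f) = heat (s + t) f := by
  have := isProbabilityMeasure_heatMeasure (n := n) hs
  have := isProbabilityMeasure_heatMeasure (n := n) ht
  ext x
  have hi := integrable_translate_heatMeasure hp (add_pos hs ht) hf x
  rw [heat_eq_integral hs, heat_eq_integral (add_pos hs ht)]
  rw [← heatMeasure_conv hs ht] at hi ⊢
  rw [integral_conv hi]
  simp_rw [heat_eq_integral ht, sub_sub]

lemma heat_sub {p : ℝ≥0∞} (hp : 1 ≤ p) {t : ℝ} (ht : 0 < t)
    {f g : EuclideanSpace ℝ (Fin n) → Y} (hf : MemLp f p) (hg : MemLp g p) :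
    heat t (f - g) = heat t f - heat t g := by
  ext x
  simp only [heat_eq_integral ht, Pi.sub_apply]
  exact integral_sub (integrable_translate_heatMeasure hp ht hf x)
    (integrable_translate_heatMeasure hp ht hg x)

lemma heat_sum_smul {p : ℝ≥0∞} (hp : 1 ≤ p) {t : ℝ} (ht : 0 < t) {ι : Type*} [Fintype ι]
    {f : ι → EuclideanSpace ℝ (Fin n) → Y} (hf : ∀ j, MemLp (f j) p) (c : ι → ℝ) :
    heat t (fun x => ∑ j, c j • f j x) = fun x => ∑ j, c j • heat t (f j) x := by
  ext x
  simp only [heat_eq_integral ht]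
  rw [integral_finsetSum (f := fun j w => c j • f j (x - w)) _ fun j _ =>
    (integrable_translate_heatMeasure hp ht (hf j) x).smul (c j)]
  simp_rw [integral_smul]

lemma heat_congr_ae {t : ℝ} {f g : EuclideanSpace ℝ (Fin n) → Y} (h : f =ᵐ[volume] g) :
    heat t f = heat t g := by
  ext x
  refine integral_congr_ae ?_
  have := (Measure.measurePreserving_sub_left volume x).quasiMeasurePreserving.ae_eq_comp h
  filter_upwards [this] with w hw
  simp only [Function.comp_apply] at hw
  rw [hw]

/-- Convolving with a measure is bounded by the average of the `L_q` norms. -/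
lemma eLpNorm_integral_sum_smul_translate_le {q : ℝ} (hq : 1 < q) {ι : Type*} [Fintype ι]
    (ν : Measure (EuclideanSpace ℝ (Fin n))) [SFinite ν]
    {c : EuclideanSpace ℝ (Fin n) → ι → ℝ} (hc : ∀ j, Measurable fun w => c w j)
    {f : ι → EuclideanSpace ℝ (Fin n) → Y} (hf : ∀ j, AEStronglyMeasurable (f j)) :
    eLpNorm (fun x => ∫ w, ∑ j, c w j • f j (x - w) ∂ν) (ENNReal.ofReal q) volume
      ≤ ∫⁻ w, eLpNorm (fun x => ∑ j, c w j • f j x) (ENNReal.ofReal q) volume ∂ν := by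
  have hq0 : 0 < q := one_pos.trans hq
  have h0 : ENNReal.ofReal q ≠ 0 := by simpa using hq0
  simp_rw [eLpNorm_eq_lintegral_rpow_enorm_toReal h0 ENNReal.ofReal_ne_top,
    ENNReal.toReal_ofReal hq0.le]
  have hm : AEStronglyMeasurable
      (fun p : EuclideanSpace ℝ (Fin n) × EuclideanSpace ℝ (Fin n) =>
        ∑ j, c p.2 j • f j (p.1 - p.2)) (volume.prod ν) := by
    refine Finset.aestronglyMeasurable_fun_sum _ fun j _ => ?_
    exact (((hc j).comp measurable_snd).aestronglyMeasurable).smul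
      (aestronglyMeasurable_comp_sub (hf j) ν)
  calc (∫⁻ x, ‖∫ w, ∑ j, c w j • f j (x - w) ∂ν‖ₑ ^ q) ^ (1 / q)
      ≤ (∫⁻ x, (∫⁻ w, ‖∑ j, c w j • f j (x - w)‖ₑ ∂ν) ^ q) ^ (1 / q) := by
        gcongr with x
        exact enorm_integral_le_lintegral_enorm _
    _ ≤ ∫⁻ w, (∫⁻ x, ‖∑ j, c w j • f j (x - w)‖ₑ ^ q) ^ (1 / q) ∂ν :=
        lintegral_rpow_lintegral_le hq hm.enorm
    _ = _ := by
        refine lintegral_congr fun w => ?_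
        congr 1
        exact lintegral_sub_right_eq_self (fun x => ‖∑ j, c w j • f j x‖ₑ ^ q) w

lemma eLpNorm_heat_le {q : ℝ} (hq : 1 < q) {t : ℝ} (ht : 0 < t)
    {f : EuclideanSpace ℝ (Fin n) → Y} (hf : AEStronglyMeasurable f) :
    eLpNorm (heat t f) (ENNReal.ofReal q) volume ≤ eLpNorm f (ENNReal.ofReal q) volume := by
  have := isProbabilityMeasure_heatMeasure (n := n) ht
  have := eLpNorm_integral_sum_smul_translate_le hq (heatMeasure n t) (ι := Unit)
    (c := fun _ _ => 1) (fun _ => measurable_const) (f := fun _ => f) (fun _ => hf)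
  simpa [← heat_eq_integral ht] using this

/-! ### Differentiability -/

/-- The Fréchet derivative of the heat kernel. -/
noncomputable def heatKernelDeriv (t : ℝ) (u : EuclideanSpace ℝ (Fin n)) :
    EuclideanSpace ℝ (Fin n) →L[ℝ] ℝ :=
  (-(heatKernel t u / (2 * t))) • innerSL ℝ u

lemma hasFDerivAt_heatKernel (t : ℝ) (u : EuclideanSpace ℝ (Fin n)) :
    HasFDerivAt (heatKernel t) (heatKernelDeriv t u) u := by
  unfold heatKernel
  have h1 : HasFDerivAt (fun x : EuclideanSpace ℝ (Fin n) => ‖x‖ ^ 2) (2 • innerSL ℝ u) u :=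
    (hasStrictFDerivAt_norm_sq u).hasFDerivAt
  have h2 := ((h1.fun_neg.mul_const (4 * t)⁻¹).exp).const_mul (1 / (4 * Real.pi * t) ^ ((n : ℝ) / 2))
  simp_rw [div_eq_mul_inv (-‖_‖ ^ 2)]
  convert! h2 using 1
  ext v
  simp only [heatKernelDeriv, heatKernel, smul_apply, innerSL_apply_apply,
    smul_eq_mul, neg_apply, nsmul_eq_mul, div_eq_mul_inv, mul_inv]
  push_cast
  ring

/-- Supplies the dominating function for differentiation under the integral. Half of the exponent at
time `t` absorbs the factor `‖u‖`; the other half, with `‖v‖² ≤ 2‖u‖² + 2`, still dominates the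
Gaussian at `v` with time `4t`. -/
lemma norm_heatKernelDeriv_le {t : ℝ} (ht : 0 < t) :
    ∃ C : ℝ, ∀ u v : EuclideanSpace ℝ (Fin n), ‖u - v‖ ≤ 1 →
      ‖heatKernelDeriv t u‖ ≤ C * heatKernel (4 * t) v := by
  have hpi := Real.pi_pos
  set a : ℝ := 1 / (4 * Real.pi * t) ^ ((n : ℝ) / 2) with ha
  set b : ℝ := 1 / (4 * Real.pi * (4 * t)) ^ ((n : ℝ) / 2) with hb
  have ha0 : 0 < a := by positivity
  have hb0 : 0 < b := by positivity
  refine ⟨a / b / (2 * t) * ((1 + 8 * t) * Real.exp (1 / (8 * t))), fun u v huv => ?_⟩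
  have hv : ‖v‖ ^ 2 ≤ 2 * ‖u‖ ^ 2 + 2 := by
    have : ‖v‖ ≤ ‖u‖ + 1 := by
      have := norm_sub_norm_le v u
      rw [norm_sub_rev] at this
      linarith
    nlinarith [norm_nonneg v, norm_nonneg u, sq_nonneg (‖u‖ - 1)]
  have h1 : ‖u‖ ≤ (1 + 8 * t) * Real.exp (‖u‖ ^ 2 / (8 * t)) := by
    have h2 := Real.add_one_le_exp (‖u‖ ^ 2 / (8 * t))
    calc ‖u‖ ≤ 1 + ‖u‖ ^ 2 := by nlinarith [sq_nonneg (‖u‖ - 1)]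
      _ ≤ (1 + 8 * t) * (‖u‖ ^ 2 / (8 * t) + 1) := by
          have : (1 + 8 * t) * (‖u‖ ^ 2 / (8 * t) + 1)
              = ‖u‖ ^ 2 / (8 * t) + ‖u‖ ^ 2 + 1 + 8 * t := by field_simp; ring
          rw [this]
          have : 0 ≤ ‖u‖ ^ 2 / (8 * t) := by positivity
          linarith
      _ ≤ _ := by gcongr
  rw [heatKernelDeriv, norm_smul, innerSL_apply_norm, norm_neg, Real.norm_eq_abs,
    abs_of_nonneg (div_nonneg (heatKernel_nonneg ht.le u) (by positivity)), heatKernel, heatKernel,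
    ← ha, ← hb]
  calc a * Real.exp (-‖u‖ ^ 2 / (4 * t)) / (2 * t) * ‖u‖
      ≤ a * Real.exp (-‖u‖ ^ 2 / (4 * t)) / (2 * t) *
          ((1 + 8 * t) * Real.exp (‖u‖ ^ 2 / (8 * t))) := by gcongr
    _ = a / (2 * t) * (1 + 8 * t) * Real.exp (-‖u‖ ^ 2 / (8 * t)) := by
        have : Real.exp (-‖u‖ ^ 2 / (8 * t))
            = Real.exp (-‖u‖ ^ 2 / (4 * t)) * Real.exp (‖u‖ ^ 2 / (8 * t)) := by
          rw [← Real.exp_add]; congr 1; field_simp; ring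
        rw [this]; ring
    _ ≤ a / (2 * t) * (1 + 8 * t) *
          (Real.exp (1 / (8 * t)) * Real.exp (-‖v‖ ^ 2 / (4 * (4 * t)))) := by
        gcongr
        rw [← Real.exp_add, Real.exp_le_exp, ← sub_nonneg]
        have : 1 / (8 * t) + -‖v‖ ^ 2 / (4 * (4 * t)) - -‖u‖ ^ 2 / (8 * t)
            = (2 * ‖u‖ ^ 2 + 2 - ‖v‖ ^ 2) / (16 * t) := by field_simp; ring
        rw [this]
        exact div_nonneg (by linarith) (by positivity)
    _ = _ := by field_simp

lemma measurable_heatKernelDeriv (t : ℝ) :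
    Measurable (heatKernelDeriv t : EuclideanSpace ℝ (Fin n) → _) :=
  ((measurable_heatKernel t).div_const _).neg.smul (innerSL ℝ).continuous.measurable

lemma hasFDerivAt_heat {p : ℝ≥0∞} (hp : 1 ≤ p) {t : ℝ} (ht : 0 < t)
    {f : EuclideanSpace ℝ (Fin n) → Y} (hf : MemLp f p) (x : EuclideanSpace ℝ (Fin n)) :
    HasFDerivAt (heat t f) (∫ y, (heatKernelDeriv t (x - y)).smulRight (f y)) x := by
  obtain ⟨C, hC⟩ := norm_heatKernelDeriv_le (n := n) ht
  -- The variable `x` is moved into the kernel, since `f` itself need not be differentiable.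
  have heq : heat t f = fun x => ∫ y, heatKernel t (x - y) • f y := by
    ext x
    rw [heat, ← integral_sub_left_eq_self _ _ x]
    simp
  have hmeas : ∀ x, AEStronglyMeasurable (fun y => heatKernel t (x - y) • f y) volume := fun x =>
    ((measurable_heatKernel t).comp (by fun_prop)).aestronglyMeasurable.smul hf.1
  rw [heq]
  refine hasFDerivAt_integral_of_dominated_of_fderiv_le
    (F := fun x y => heatKernel t (x - y) • f y)
    (F' := fun x y => (heatKernelDeriv t (x - y)).smulRight (f y))
    (bound := fun y => C * (heatKernel (4 * t) (x - y) * ‖f y‖))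
    (Metric.closedBall_mem_nhds x one_pos) (.of_forall hmeas) ?_ ?_ ?_ ?_ ?_
  · refine (integrable_heatKernel_mul_norm hp ht hf x).mono' (hmeas x) (.of_forall fun y => ?_)
    rw [norm_smul, Real.norm_eq_abs, abs_of_nonneg (heatKernel_nonneg ht.le _)]
  · have h1 : AEStronglyMeasurable (fun y => heatKernelDeriv t (x - y)) volume :=
      ((measurable_heatKernelDeriv t).comp (by fun_prop)).aestronglyMeasurable
    exact (ContinuousLinearMap.smulRightL ℝ (EuclideanSpace ℝ (Fin n)) Y).aestronglyMeasurable_comp₂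
      h1 hf.1
  · refine .of_forall fun y z hz => ?_
    rw [ContinuousLinearMap.norm_smulRight_apply, ← mul_assoc]
    gcongr
    refine hC _ _ ?_
    rw [sub_sub_sub_cancel_right]
    simpa [dist_eq_norm] using hz
  · exact (integrable_heatKernel_mul_norm hp (by positivity) hf x).const_mul C
  · refine .of_forall fun y z _ => ?_
    have h1 : HasFDerivAt (fun z => heatKernel t (z - y)) (heatKernelDeriv t (z - y)) z := by
      exact (hasFDerivAt_heatKernel t (z - y)).comp z ((hasFDerivAt_id z).sub_const y)
    simpa using h1.smul_const (f y)

lemma differentiable_heat {p : ℝ≥0∞} (hp : 1 ≤ p) {t : ℝ} (ht : 0 < t)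
    {f : EuclideanSpace ℝ (Fin n) → Y} (hf : MemLp f p) : Differentiable ℝ (heat t f) :=
  fun x => (hasFDerivAt_heat hp ht hf x).differentiableAt

lemma memLp_heat {q : ℝ} (hq : 1 < q) {t : ℝ} (ht : 0 < t)
    {f : EuclideanSpace ℝ (Fin n) → Y} (hf : MemLp f (ENNReal.ofReal q)) :
    MemLp (heat t f) (ENNReal.ofReal q) := by
  refine ⟨?_, (eLpNorm_heat_le hq ht hf.1).trans_lt hf.2⟩
  exact (differentiable_heat (by simpa using hq.le) ht hf).continuous.aestronglyMeasurable

lemma integrable_inner_smul_translate {p : ℝ≥0∞} (hp : 1 ≤ p) {t : ℝ} (ht : 0 < t)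
    {f : EuclideanSpace ℝ (Fin n) → Y} (hf : MemLp f p) (x z : EuclideanSpace ℝ (Fin n)) :
    Integrable (fun w => (inner ℝ w z : ℝ) • f (x - w)) (heatMeasure n t) := by
  obtain ⟨C, hC⟩ := norm_heatKernelDeriv_le (n := n) ht
  rw [heatMeasure, integrable_withDensity_iff_integrable_smul'
    (measurable_heatKernel t).ennreal_ofReal (by simp)]
  have h4 := (integrable_heatKernel_mul_norm hp (t := 4 * t) (by positivity) hf x).comp_sub_left x
  refine (h4.const_mul (2 * t * C * ‖z‖)).mono' ?_ (.of_forall fun w => ?_)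
  · have h1 : MemLp (fun w => f (x - w)) p volume :=
      hf.comp_measurePreserving (Measure.measurePreserving_sub_left volume x)
    exact ((measurable_heatKernel t).ennreal_ofReal.ennreal_toReal).aestronglyMeasurable.smul
      ((by fun_prop : Measurable fun w => (inner ℝ w z : ℝ)).aestronglyMeasurable.smul h1.1)
  · rw [ENNReal.toReal_ofReal (heatKernel_nonneg ht.le _), sub_sub_cancel, norm_smul, norm_smul,
      ← mul_assoc, ← mul_assoc, Real.norm_eq_abs, abs_of_nonneg (heatKernel_nonneg ht.le _)]
    refine mul_le_mul_of_nonneg_right ?_ (norm_nonneg _)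
    have h1 := hC w w (by simp)
    rw [heatKernelDeriv, norm_smul, innerSL_apply_norm, norm_neg, Real.norm_eq_abs,
      abs_of_nonneg (div_nonneg (heatKernel_nonneg ht.le w) (by positivity))] at h1
    have h2 := norm_inner_le_norm (𝕜 := ℝ) w z
    calc heatKernel t w * ‖(inner ℝ w z : ℝ)‖ ≤ heatKernel t w * (‖w‖ * ‖z‖) := by
          gcongr; exact heatKernel_nonneg ht.le w
      _ = 2 * t * (heatKernel t w / (2 * t) * ‖w‖) * ‖z‖ := by field_simp
      _ ≤ 2 * t * (C * heatKernel (4 * t) w) * ‖z‖ := by gcongr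
      _ = _ := by ring

lemma lineDeriv_heat [CompleteSpace Y] {p : ℝ≥0∞} (hp : 1 ≤ p) {t : ℝ} (ht : 0 < t)
    {f : EuclideanSpace ℝ (Fin n) → Y} (hf : MemLp f p) (x z : EuclideanSpace ℝ (Fin n)) :
    lineDeriv ℝ (heat t f) x z
      = (-(1 / (2 * t))) • ∫ w, (inner ℝ w z : ℝ) • f (x - w) ∂heatMeasure n t := by
  obtain ⟨C, hC⟩ := norm_heatKernelDeriv_le (n := n) ht
  have hint : Integrable fun y => (heatKernelDeriv t (x - y)).smulRight (f y) := by
    refine ((integrable_heatKernel_mul_norm hp (t := 4 * t) (by positivity) hf x).const_mul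
      C).mono' ?_ (.of_forall fun y => ?_)
    · have h1 : AEStronglyMeasurable (fun y => heatKernelDeriv t (x - y)) volume :=
        ((measurable_heatKernelDeriv t).comp (by fun_prop)).aestronglyMeasurable
      exact (ContinuousLinearMap.smulRightL ℝ
        (EuclideanSpace ℝ (Fin n)) Y).aestronglyMeasurable_comp₂ h1 hf.1
    · rw [ContinuousLinearMap.norm_smulRight_apply, ← mul_assoc]
      gcongr
      exact hC _ _ (by simp)
  have h := hasFDerivAt_heat hp ht hf x
  rw [h.differentiableAt.lineDeriv_eq_fderiv, h.fderiv, ContinuousLinearMap.integral_apply hint,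
    integral_heatMeasure ht.le, ← integral_smul, ← integral_sub_left_eq_self _ _ x]
  refine integral_congr_ae (.of_forall fun w => ?_)
  simp only [ContinuousLinearMap.smulRight_apply, heatKernelDeriv, sub_sub_cancel,
    smul_apply, innerSL_apply_apply, smul_smul, smul_eq_mul]
  congr 1
  ring

end HeatOperator

/-! ### The cotype inequality without normalisation -/

section MartingaleCotype

variable {Y : Type*} [NormedAddCommGroup Y] [NormedSpace ℝ Y] [CompleteSpace Y]

/-- The constant is defined through martingales with supremum exactly `1`; rescaling by `S ^ (-1 /
q)` reaches this case. If `S = 0` no rescaling exists, but then the martingale vanishes almost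
surely. -/
lemma tsum_lintegral_martingale_sub_le {q : ℝ} (hq : 0 < q) {Ω : Type} {mΩ : MeasurableSpace Ω}
    {μ : Measure Ω} [IsProbabilityMeasure μ] {ℱ : Filtration ℕ mΩ} {M : ℕ → Ω → Y}
    (hM : Martingale M ℱ μ) {A : ℝ≥0∞} (hA : A ≠ ∞)
    (hbound : ∀ k, ∫⁻ ω, ‖M k ω‖ₑ ^ q ∂μ ≤ A) :
    ∑' k, ∫⁻ ω, ‖M (k + 1) ω - M k ω‖ₑ ^ q ∂μ ≤ martingaleCotypeConst q Y ^ q * A := by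
  set S := ⨆ k, ∫⁻ ω, ‖M k ω‖ₑ ^ q ∂μ with hS
  have hSA : S ≤ A := iSup_le hbound
  have hSfin : S ≠ ∞ := ne_top_of_le_ne_top hA hSA
  refine le_trans ?_ (mul_le_mul_right hSA _)
  have hmeas : ∀ k, AEStronglyMeasurable (M k) μ := fun k =>
    ((hM.1 k).mono (ℱ.le k)).aestronglyMeasurable
  rcases eq_or_ne S 0 with h0 | h0
  · have hzero : ∀ k, M k =ᵐ[μ] 0 := by
      intro k
      have h1 : ∫⁻ ω, ‖M k ω‖ₑ ^ q ∂μ = 0 :=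
        le_antisymm ((le_iSup (fun k => ∫⁻ ω, ‖M k ω‖ₑ ^ q ∂μ) k).trans h0.le) zero_le
      rw [lintegral_eq_zero_iff' ((hmeas k).enorm.pow_const q)] at h1
      filter_upwards [h1] with ω hω
      simpa [hq, hq.le, hq.not_gt] using hω
    have : ∀ k, ∫⁻ ω, ‖M (k + 1) ω - M k ω‖ₑ ^ q ∂μ = 0 := by
      intro k
      rw [lintegral_eq_zero_iff' (((hmeas _).fun_sub (hmeas k)).enorm.pow_const q)]
      filter_upwards [hzero k, hzero (k + 1)] with ω h1 h2
      simp [h1, h2, hq]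
    simp [this]
  set c : ℝ := S.toReal ^ (-1 / q) with hc
  have hSpos : 0 < S.toReal := ENNReal.toReal_pos h0 hSfin
  have hcq : ‖c‖ₑ ^ q = S⁻¹ := by
    rw [Real.enorm_eq_ofReal (by positivity), ENNReal.ofReal_rpow_of_nonneg (by positivity) hq.le,
      hc, ← Real.rpow_mul hSpos.le, div_mul_cancel₀ _ hq.ne', Real.rpow_neg_one,
      ENNReal.ofReal_inv_of_pos hSpos, ENNReal.ofReal_toReal hSfin]
  have hscale : ∀ g : Ω → Y,
      ∫⁻ ω, ‖c • g ω‖ₑ ^ q ∂μ = S⁻¹ * ∫⁻ ω, ‖g ω‖ₑ ^ q ∂μ := by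
    intro g
    rw [← lintegral_const_mul' _ _ (ENNReal.inv_ne_top.2 h0)]
    refine lintegral_congr fun ω => ?_
    rw [enorm_smul, ENNReal.mul_rpow_of_nonneg _ _ hq.le, hcq]
  have hM' : Martingale (c • M) ℱ μ := hM.smul c
  have hsup : ⨆ k, ∫⁻ ω, ‖(c • M) k ω‖ₑ ^ q ∂μ = 1 := by
    simp only [Pi.smul_apply, hscale]
    rw [← ENNReal.mul_iSup, ← hS, ENNReal.inv_mul_cancel h0 hSfin]
  have key : (∑' k, ∫⁻ ω, ‖(c • M) (k + 1) ω - (c • M) k ω‖ₑ ^ q ∂μ) ^ (1 / q)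
      ≤ martingaleCotypeConst q Y := by
    unfold martingaleCotypeConst
    exact le_iSup_of_le Ω <| le_iSup_of_le mΩ <| le_iSup_of_le μ <| le_iSup_of_le inferInstance <|
      le_iSup_of_le ℱ <| le_iSup_of_le (c • M) <| le_iSup_of_le hM' <| le_iSup_of_le hsup le_rfl
  simp only [Pi.smul_apply, ← smul_sub, hscale] at key
  rw [ENNReal.tsum_mul_left, one_div, ENNReal.rpow_inv_le_iff hq, mul_comm, ← div_eq_mul_inv,
    ENNReal.div_le_iff h0 hSfin] at key
  exact key

end MartingaleCotype

/-- The position after `k` steps of the walk with starting point `ω 0` and increments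
`-ω 1, -ω 2, …`. -/
def walk {V : Type} [AddCommGroup V] (k : ℕ) (ω : ℕ → V) : V := ω 0 - ∑ i : Fin k, ω (i + 1)

lemma walk_succ {V : Type} [AddCommGroup V] (k : ℕ) (ω : ℕ → V) :
    walk (k + 1) ω = walk k ω - ω (k + 1) := by
  simp [walk, Fin.sum_univ_castSucc, sub_sub]

/-! ### Independence of the past and the next increment -/

section Independence

/-- Initial law `ρ` followed by the laws `γ k` of the increments. -/
def stepMeasure {V : Type} [MeasurableSpace V] (ρ : Measure V) (γ : ℕ → Measure V) : ℕ → Measure V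
  | 0 => ρ
  | k + 1 => γ k

instance {V : Type} [MeasurableSpace V] (ρ : Measure V) [IsProbabilityMeasure ρ] (γ : ℕ → Measure V)
    [∀ k, IsProbabilityMeasure (γ k)] (k : ℕ) : IsProbabilityMeasure (stepMeasure ρ γ k) := by
  cases k <;> (unfold stepMeasure; infer_instance)

variable {V : Type} [MeasurableSpace V] (ρ : Measure V) [IsProbabilityMeasure ρ]
  (γ : ℕ → Measure V) [∀ k, IsProbabilityMeasure (γ k)]

/-- The only form in which independence is used: a product law lets Fubini stand in for conditional
expectation. -/
lemma map_frestrictLe_prod_eval (k : ℕ) :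
    (Measure.infinitePi (stepMeasure ρ γ)).map
        (fun ω => (Preorder.frestrictLe (π := fun _ => V) k ω, ω (k + 1)))
      = ((Measure.infinitePi (stepMeasure ρ γ)).map
          (Preorder.frestrictLe (π := fun _ => V) k)).prod (γ k) := by
  have h := ProbabilityTheory.iIndepFun_infinitePi (P := stepMeasure ρ γ)
    (X := fun _ => (id : V → V)) (fun _ => measurable_id)
  have h2 : ProbabilityTheory.IndepFun (Preorder.frestrictLe (π := fun _ => V) k)
      (fun ω => ω (k + 1)) (Measure.infinitePi (stepMeasure ρ γ)) :=
    (h.indepFun_finset (Finset.Iic k) {k + 1} (by simp) (fun i => measurable_pi_apply i)).comp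
      (φ := id) (ψ := fun a : ({k + 1} : Finset ℕ) → V => a ⟨k + 1, Finset.mem_singleton_self _⟩)
      measurable_id (measurable_pi_apply (⟨k + 1, Finset.mem_singleton_self _⟩ : ({k + 1} : Finset ℕ)))
  have hm : Measurable (Preorder.frestrictLe (π := fun _ : ℕ => V) k) := by fun_prop
  have h3 := (ProbabilityTheory.indepFun_iff_map_prod_eq_prod_map_map hm.aemeasurable
    (measurable_pi_apply (k + 1)).aemeasurable).1 h2
  have h4 : (Measure.infinitePi (stepMeasure ρ γ)).map (fun ω => ω (k + 1)) = γ k :=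
    Measure.infinitePi_map_eval (stepMeasure ρ γ) (k + 1)
  rw [h3, h4]

end Independence

/-! ### Random walks and the martingales they carry -/

section RandomWalk

variable {V : Type} [NormedAddCommGroup V] [MeasurableSpace V] [BorelSpace V]
  [SecondCountableTopology V]

lemma measurable_walk (k : ℕ) : Measurable (walk k : (ℕ → V) → V) := by
  unfold walk; fun_prop

lemma walk_eq_comp_frestrictLe (k : ℕ) : ∃ φ : ((i : Finset.Iic k) → V) → V, Measurable φ ∧
    (walk k : (ℕ → V) → V) = φ ∘ Preorder.frestrictLe (π := fun _ => V) k := by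
  refine ⟨fun a => a ⟨0, by simp⟩ - ∑ i : Fin k, a ⟨i + 1, by simp⟩, by fun_prop, ?_⟩
  ext ω
  simp [walk]

variable (ρ : Measure V) [IsProbabilityMeasure ρ] (γ : ℕ → Measure V)
  [∀ k, IsProbabilityMeasure (γ k)]

lemma lintegral_walk_step (k : ℕ) {Φ : V → V → ℝ≥0∞} (hΦ : Measurable (Function.uncurry Φ)) :
    ∫⁻ ω, Φ (walk k ω) (ω (k + 1)) ∂Measure.infinitePi (stepMeasure ρ γ)
      = ∫⁻ ω, ∫⁻ g, Φ (walk k ω) g ∂γ k ∂Measure.infinitePi (stepMeasure ρ γ) := by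
  obtain ⟨φ, hφ, hw⟩ := walk_eq_comp_frestrictLe (V := V) k
  have hm : Measurable (Preorder.frestrictLe (π := fun _ : ℕ => V) k) := by fun_prop
  have hΦ' : Measurable fun p : ((i : Finset.Iic k) → V) × V => Φ (φ p.1) p.2 :=
    hΦ.comp ((hφ.comp measurable_fst).prodMk measurable_snd)
  have h1 := lintegral_map (μ := Measure.infinitePi (stepMeasure ρ γ)) hΦ'
    (hm.prodMk (measurable_pi_apply (k + 1)))
  rw [map_frestrictLe_prod_eval, lintegral_prod _ hΦ'.aemeasurable,
    lintegral_map hΦ'.lintegral_prod_right hm] at h1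
  simp only [hw, Function.comp_apply]
  exact h1.symm

lemma setIntegral_walk_step {Y : Type*} [NormedAddCommGroup Y] [NormedSpace ℝ Y] (k : ℕ)
    {g : V → Y} (hg : Continuous g)
    (hint : Integrable (fun ω => g (walk (k + 1) ω)) (Measure.infinitePi (stepMeasure ρ γ)))
    {s : Set (ℕ → V)} (hs : MeasurableSet[Filtration.piLE (X := fun _ => V) k] s) :
    ∫ ω in s, g (walk (k + 1) ω) ∂Measure.infinitePi (stepMeasure ρ γ)
      = ∫ ω in s, ∫ w, g (walk k ω - w) ∂γ k ∂Measure.infinitePi (stepMeasure ρ γ) := by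
  obtain ⟨φ, hφ, hw⟩ := walk_eq_comp_frestrictLe (V := V) k
  have hm : Measurable (Preorder.frestrictLe (π := fun _ : ℕ => V) k) := by fun_prop
  have hme : Measurable fun ω : ℕ → V =>
      (Preorder.frestrictLe (π := fun _ : ℕ => V) k ω, ω (k + 1)) :=
    hm.prodMk (measurable_pi_apply (k + 1))
  rw [Filtration.piLE_eq_comap_frestrictLe] at hs
  obtain ⟨B, hB, rfl⟩ := hs
  set μ := Measure.infinitePi (stepMeasure ρ γ)
  set F : ((i : Finset.Iic k) → V) × V → Y := fun p => g (φ p.1 - p.2) with hF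
  have hFm : StronglyMeasurable F :=
    hg.stronglyMeasurable.comp_measurable ((hφ.comp measurable_fst).sub measurable_snd)
  have hFw : ∀ ω, F (Preorder.frestrictLe (π := fun _ => V) k ω, ω (k + 1))
      = g (walk (k + 1) ω) := fun ω => by
    simp [hF, walk_succ, hw]
  have hFint : Integrable F ((μ.map (Preorder.frestrictLe (π := fun _ => V) k)).prod (γ k)) := by
    rw [← map_frestrictLe_prod_eval, integrable_map_measure hFm.aestronglyMeasurable
      hme.aemeasurable]
    exact hint.congr (.of_forall fun ω => (hFw ω).symm)
  have h1 := setIntegral_map (μ := μ) (s := B ×ˢ Set.univ) (hB.prod .univ)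
    (hFm.aestronglyMeasurable) hme.aemeasurable
  have : IsProbabilityMeasure (μ.map (Preorder.frestrictLe (π := fun _ => V) k)) :=
    Measure.isProbabilityMeasure_map hm.aemeasurable
  rw [map_frestrictLe_prod_eval, setIntegral_prod _ hFint.integrableOn, Measure.restrict_univ,
    setIntegral_map hB hFm.integral_prod_right.aestronglyMeasurable hm.aemeasurable] at h1
  simp only [hFw] at h1
  have h2 : (fun ω : ℕ → V => (Preorder.frestrictLe (π := fun _ : ℕ => V) k ω, ω (k + 1))) ⁻¹'
      (B ×ˢ Set.univ) = Preorder.frestrictLe (π := fun _ : ℕ => V) k ⁻¹' B := by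
    ext ω; simp
  rw [h2] at h1
  simp only [hw, Function.comp_apply]
  exact h1.symm

/-- `hstep` says that `g` is space-time harmonic for the walk; integrating the next step out over
events of the past gives the martingale property. -/
lemma martingale_walk {Y : Type*} [NormedAddCommGroup Y] [NormedSpace ℝ Y] [CompleteSpace Y]
    {g : ℕ → V → Y} (hg : ∀ k, Continuous (g k))
    (hint : ∀ k, Integrable (fun ω => g k (walk k ω)) (Measure.infinitePi (stepMeasure ρ γ)))
    (hstep : ∀ k z, g k z = ∫ w, g (k + 1) (z - w) ∂γ k) :
    Martingale (fun k ω => g k (walk k ω)) (Filtration.piLE (X := fun _ => V))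
      (Measure.infinitePi (stepMeasure ρ γ)) := by
  refine martingale_of_setIntegral_eq_succ (fun k => ?_) hint fun k s hs => ?_
  · obtain ⟨φ, hφ, hw⟩ := walk_eq_comp_frestrictLe (V := V) k
    rw [hw, Filtration.piLE_eq_comap_frestrictLe]
    exact ((hg k).stronglyMeasurable.comp_measurable hφ).comp_measurable
      (comap_measurable (Preorder.frestrictLe (π := fun _ => V) k))
  · rw [setIntegral_walk_step ρ γ k (hg (k + 1)) (hint (k + 1)) hs]
    simp_rw [hstep k]

/-- The law of the sum of the first `k` increments. -/
noncomputable def sumMeasure (γ : ℕ → Measure V) : ℕ → Measure V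
  | 0 => Measure.dirac 0
  | k + 1 => (sumMeasure γ k).conv (γ k)

instance (k : ℕ) : IsProbabilityMeasure (sumMeasure γ k) := by
  induction k with
  | zero => unfold sumMeasure; infer_instance
  | succ k ih => unfold sumMeasure; infer_instance

lemma lintegral_walk (k : ℕ) {Φ : V → ℝ≥0∞} (hΦ : Measurable Φ) :
    ∫⁻ ω, Φ (walk k ω) ∂Measure.infinitePi (stepMeasure ρ γ)
      = ∫⁻ x, ∫⁻ h, Φ (x - h) ∂sumMeasure γ k ∂ρ := by
  induction k generalizing Φ with
  | zero =>
    have h4 : (Measure.infinitePi (stepMeasure ρ γ)).map (fun ω => ω 0) = ρ :=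
      Measure.infinitePi_map_eval (stepMeasure ρ γ) 0
    simp only [walk, sumMeasure, Finset.univ_eq_empty, Finset.sum_empty, sub_zero]
    simp_rw [lintegral_dirac, sub_zero]
    conv_rhs => rw [← h4]
    rw [lintegral_map hΦ (measurable_pi_apply 0)]
  | succ k ih =>
    simp only [walk_succ, sumMeasure]
    rw [lintegral_walk_step ρ γ k (Φ := fun z g => Φ (z - g)) (hΦ.comp measurable_sub),
      ih (Φ := fun z => ∫⁻ g, Φ (z - g) ∂γ k)
        (Measurable.lintegral_prod_right (hΦ.comp measurable_sub))]
    refine lintegral_congr fun x => ?_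
    rw [Measure.lintegral_conv (f := fun h => Φ (x - h)) (hΦ.comp (measurable_const.sub measurable_id))]
    simp_rw [sub_sub]

end RandomWalk

/-! ### Cotype bound for differences of the heat semigroup -/

section HeatMartingale

variable {n : ℕ}

lemma lintegral_translate_eq {Φ : EuclideanSpace ℝ (Fin n) → ℝ≥0∞} (hΦ : Measurable Φ)
    (ν : Measure (EuclideanSpace ℝ (Fin n))) [IsProbabilityMeasure ν] :
    ∫⁻ x, ∫⁻ h, Φ (x - h) ∂ν = ∫⁻ x, Φ x := by
  rw [lintegral_lintegral_swap (f := fun x h => Φ (x - h)) (hΦ.comp measurable_sub).aemeasurable]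
  simp_rw [lintegral_sub_right_eq_self (fun x => Φ x)]
  simp

lemma eLpNorm_ofReal_rpow {α Z : Type*} [MeasurableSpace α] {μ : Measure α}
    [NormedAddCommGroup Z] {q : ℝ} (hq : 0 < q) (f : α → Z) :
    eLpNorm f (ENNReal.ofReal q) μ ^ q = ∫⁻ x, ‖f x‖ₑ ^ q ∂μ := by
  rw [eLpNorm_eq_lintegral_rpow_enorm_toReal (by simpa using hq) ENNReal.ofReal_ne_top,
    ENNReal.toReal_ofReal hq.le, ← ENNReal.rpow_mul, one_div_mul_cancel hq.ne', ENNReal.rpow_one]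

lemma lintegral_rpow_le_of_isProbabilityMeasure {α : Type*} [MeasurableSpace α] {μ : Measure α}
    [IsProbabilityMeasure μ] {q : ℝ} (hq : 1 ≤ q) {f : α → ℝ≥0∞} (hf : AEMeasurable f μ) :
    (∫⁻ x, f x ∂μ) ^ q ≤ ∫⁻ x, f x ^ q ∂μ := by
  have hq0 : 0 < q := one_pos.trans_le hq
  have h := eLpNorm_le_eLpNorm_of_exponent_le (μ := μ) (p := 1) (q := ENNReal.ofReal q)
    (by simpa using hq) hf.aestronglyMeasurable
  rw [eLpNorm_one_eq_lintegral_enorm, eLpNorm_eq_lintegral_rpow_enorm_toReal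
    (by simpa using hq0) ENNReal.ofReal_ne_top, ENNReal.toReal_ofReal hq0.le, one_div,
    ENNReal.le_rpow_inv_iff hq0] at h
  simpa using h

variable {Y : Type*} [NormedAddCommGroup Y] [NormedSpace ℝ Y] [CompleteSpace Y]

/-- Cotype bound for the walk started uniformly on `B`. -/
lemma setLIntegral_tsum_walk_le {q : ℝ} (hq : 1 < q)
    {g : ℕ → EuclideanSpace ℝ (Fin n) → Y} (hg : ∀ k, Continuous (g k))
    {γ : ℕ → Measure (EuclideanSpace ℝ (Fin n))} [∀ k, IsProbabilityMeasure (γ k)]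
    (hstep : ∀ k z, g k z = ∫ w, g (k + 1) (z - w) ∂γ k)
    {A : ℝ≥0∞} (hA : A ≠ ∞) (hbound : ∀ k, ∫⁻ x, ‖g k x‖ₑ ^ q ≤ A)
    {B : Set (EuclideanSpace ℝ (Fin n))} (hB0 : volume B ≠ 0)
    (hB1 : volume B ≠ ∞) :
    ∫⁻ x in B, ∑' k, ∫⁻ h, ∫⁻ w, ‖g (k + 1) (x - h - w) - g k (x - h)‖ₑ ^ q ∂γ k ∂sumMeasure γ k
      ≤ martingaleCotypeConst q Y ^ q * A := by
  have hq0 : 0 < q := one_pos.trans hq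
  set ρ := ProbabilityTheory.cond volume B with hρ
  have : IsProbabilityMeasure ρ := ProbabilityTheory.cond_isProbabilityMeasure_of_finite hB0 hB1
  have hρint : ∀ F : EuclideanSpace ℝ (Fin n) → ℝ≥0∞,
      ∫⁻ x, F x ∂ρ = (volume B)⁻¹ * ∫⁻ x in B, F x := fun F => by
    rw [hρ, ProbabilityTheory.cond, lintegral_smul_measure, smul_eq_mul]
  have hwb : ∀ k, ∫⁻ ω, ‖g k (walk k ω)‖ₑ ^ q ∂Measure.infinitePi (stepMeasure ρ γ) ≤ (volume B)⁻¹ * A := by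
    intro k
    have hm : Measurable fun x => ‖g k x‖ₑ ^ q := (hg k).enorm.measurable.pow_const q
    rw [lintegral_walk ρ γ k (Φ := fun x => ‖g k x‖ₑ ^ q) hm, hρint]
    gcongr
    refine le_trans (setLIntegral_le_lintegral _ _) ?_
    exact (lintegral_translate_eq hm _).le.trans (hbound k)
  have hfin : (volume B)⁻¹ * A ≠ ∞ := ENNReal.mul_ne_top (ENNReal.inv_ne_top.2 hB0) hA
  have hint : ∀ k, Integrable (fun ω => g k (walk k ω))
      (Measure.infinitePi (stepMeasure ρ γ)) := by
    intro k
    have hlp : MemLp (fun ω => g k (walk k ω)) (ENNReal.ofReal q)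
        (Measure.infinitePi (stepMeasure ρ γ)) := by
      refine ⟨((hg k).stronglyMeasurable.comp_measurable (measurable_walk k)).aestronglyMeasurable,
        ?_⟩
      have h1 := (hwb k).trans_lt hfin.lt_top
      rw [← eLpNorm_ofReal_rpow hq0] at h1
      exact (ENNReal.rpow_lt_top_iff_of_pos hq0).1 h1
    exact hlp.integrable (by simpa using hq.le)
  have hM := martingale_walk ρ γ hg hint hstep
  have key := tsum_lintegral_martingale_sub_le hq0 hM hfin hwb
  have hΦ : ∀ k, Measurable (Function.uncurry fun z w : EuclideanSpace ℝ (Fin n) =>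
      ‖g (k + 1) (z - w) - g k z‖ₑ ^ q) := by
    intro k
    have h1 := hg k
    have h2 := hg (k + 1)
    have h3 : Continuous (Function.uncurry fun z w : EuclideanSpace ℝ (Fin n) =>
        g (k + 1) (z - w) - g k z) := by
      unfold Function.uncurry
      fun_prop
    exact h3.enorm.measurable.pow_const q
  have hterm : ∀ k, ∫⁻ ω, ‖g (k + 1) (walk (k + 1) ω) - g k (walk k ω)‖ₑ ^ q ∂Measure.infinitePi (stepMeasure ρ γ)
      = (volume B)⁻¹ * ∫⁻ x in B, ∫⁻ h, ∫⁻ w,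
          ‖g (k + 1) (x - h - w) - g k (x - h)‖ₑ ^ q ∂γ k ∂sumMeasure γ k := by
    intro k
    simp_rw [walk_succ k]
    rw [lintegral_walk_step ρ γ k (Φ := fun z w => ‖g (k + 1) (z - w) - g k z‖ₑ ^ q) (hΦ k),
      lintegral_walk ρ γ k (Φ := fun z => ∫⁻ w, ‖g (k + 1) (z - w) - g k z‖ₑ ^ q ∂γ k)
        (hΦ k).lintegral_prod_right, hρint]
  beta_reduce at key
  simp_rw [hterm] at key
  -- Both sides carry the factor `(volume B)⁻¹`; cancelling it leaves a bound uniform in `B`.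
  rw [ENNReal.tsum_mul_left, ← lintegral_tsum, mul_left_comm,
    ENNReal.mul_le_mul_iff_right (ENNReal.inv_ne_zero.2 hB1) (ENNReal.inv_ne_top.2 hB0)] at key
  · exact key
  · intro k
    refine Measurable.aemeasurable ?_
    exact Measurable.lintegral_prod_right ((hΦ k).lintegral_prod_right.comp measurable_sub)

/-- Lebesgue measure is not a probability, so it cannot be the initial law. Translation invariance
inserts the law of the accumulated steps, and the bound for balls, being uniform, passes to the
whole space by monotone convergence. -/
lemma tsum_lintegral_increment_le {q : ℝ} (hq : 1 < q)
    {g : ℕ → EuclideanSpace ℝ (Fin n) → Y} (hg : ∀ k, Continuous (g k))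
    {γ : ℕ → Measure (EuclideanSpace ℝ (Fin n))} [∀ k, IsProbabilityMeasure (γ k)]
    (hstep : ∀ k z, g k z = ∫ w, g (k + 1) (z - w) ∂γ k)
    {A : ℝ≥0∞} (hA : A ≠ ∞) (hbound : ∀ k, ∫⁻ x, ‖g k x‖ₑ ^ q ≤ A) :
    ∑' k, ∫⁻ z, ∫⁻ w, ‖g (k + 1) (z - w) - g k z‖ₑ ^ q ∂γ k
      ≤ martingaleCotypeConst q Y ^ q * A := by
  have hΦ : ∀ k, Measurable (Function.uncurry fun z w : EuclideanSpace ℝ (Fin n) =>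
      ‖g (k + 1) (z - w) - g k z‖ₑ ^ q) := by
    intro k
    have h1 := hg k
    have h2 := hg (k + 1)
    have h3 : Continuous (Function.uncurry fun z w : EuclideanSpace ℝ (Fin n) =>
        g (k + 1) (z - w) - g k z) := by
      unfold Function.uncurry
      fun_prop
    exact h3.enorm.measurable.pow_const q
  have h1 : ∀ k, ∫⁻ z, ∫⁻ w, ‖g (k + 1) (z - w) - g k z‖ₑ ^ q ∂γ k
      = ∫⁻ x, ∫⁻ h, ∫⁻ w, ‖g (k + 1) (x - h - w) - g k (x - h)‖ₑ ^ q ∂γ k ∂sumMeasure γ k :=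
    fun k => (lintegral_translate_eq (hΦ k).lintegral_prod_right (sumMeasure γ k)).symm
  simp_rw [h1]
  rw [← lintegral_tsum]
  · have hmono : Monotone fun R : ℕ => Metric.ball (0 : EuclideanSpace ℝ (Fin n)) (R + 1) := by
      intro a b hab
      exact Metric.ball_subset_ball (by gcongr)
    have huniv : ⋃ R : ℕ, Metric.ball (0 : EuclideanSpace ℝ (Fin n)) (R + 1) = Set.univ := by
      refine Set.eq_univ_of_forall fun x => Set.mem_iUnion.2 ?_
      obtain ⟨R, hR⟩ := exists_nat_gt ‖x‖
      exact ⟨R, by simp; linarith⟩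
    rw [← setLIntegral_univ, ← huniv, setLIntegral_iUnion_of_directed _ hmono.directed_le]
    refine iSup_le fun R => setLIntegral_tsum_walk_le hq hg hstep hA hbound ?_
      measure_ball_lt_top.ne
    exact (Metric.measure_ball_pos _ _ (by positivity)).ne'
  · intro k
    refine Measurable.aemeasurable ?_
    exact Measurable.lintegral_prod_right ((hΦ k).lintegral_prod_right.comp measurable_sub)

/-- Reverse the step: fix the endpoint `y = z - w` and average over the starting point `y + w`. By
symmetry of the Gaussian the mean of `H_{2u} f (y + w)` is `H_{3u} f (y)`, and Jensen's inequality
applies. -/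
lemma eLpNorm_heat_sub_heat_rpow_le {q : ℝ} (hq : 1 < q) {u : ℝ} (hu : 0 < u)
    {f : EuclideanSpace ℝ (Fin n) → Y} (hf : MemLp f (ENNReal.ofReal q)) :
    eLpNorm (heat u f - heat (3 * u) f) (ENNReal.ofReal q) volume ^ q
      ≤ ∫⁻ z, ∫⁻ w, ‖heat u f (z - w) - heat (2 * u) f z‖ₑ ^ q ∂heatMeasure n u := by
  have hq0 : 0 < q := one_pos.trans hq
  have hq1 : 1 ≤ ENNReal.ofReal q := by simpa using hq.le
  have := isProbabilityMeasure_heatMeasure (n := n) hu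
  have hc1 := (differentiable_heat hq1 hu hf).continuous
  have hc2 := (differentiable_heat hq1 (t := 2 * u) (by positivity) hf).continuous
  have hm : ∀ F : EuclideanSpace ℝ (Fin n) × EuclideanSpace ℝ (Fin n) → Y, Continuous F →
      Measurable fun p => ‖F p‖ₑ ^ q := fun F hF => hF.enorm.measurable.pow_const q
  calc eLpNorm (heat u f - heat (3 * u) f) (ENNReal.ofReal q) volume ^ q
      = ∫⁻ y, ‖heat u f y - heat (3 * u) f y‖ₑ ^ q := eLpNorm_ofReal_rpow hq0 _
    _ ≤ ∫⁻ y, ∫⁻ w, ‖heat u f y - heat (2 * u) f (y + w)‖ₑ ^ q ∂heatMeasure n u := by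
        refine lintegral_mono fun y => ?_
        have h2 : Integrable (fun w => heat (2 * u) f (y + w)) (heatMeasure n u) := by
          have hc3 : Continuous fun w => heat (2 * u) f (y - w) := by fun_prop
          have h := integrable_translate_heatMeasure hq1 hu
            (memLp_heat hq (t := 2 * u) (by positivity) hf) y
          rw [← map_neg_heatMeasure hu, integrable_map_measure
            hc3.aestronglyMeasurable (by fun_prop)] at h
          simpa [Function.comp_def] using h
        have h3 : heat (3 * u) f y = ∫ w, heat (2 * u) f (y + w) ∂heatMeasure n u := by
          have hc3 : Continuous fun w => heat (2 * u) f (y - w) := by fun_prop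
          have h31 : 3 * u = u + 2 * u := by ring
          rw [h31, ← heat_heat hq1 hu (by positivity) hf, heat_eq_integral hu]
          conv_lhs => rw [← map_neg_heatMeasure hu]
          rw [integral_map (by fun_prop) hc3.aestronglyMeasurable]
          simp
        have h4 : heat u f y - heat (3 * u) f y
            = ∫ w, (heat u f y - heat (2 * u) f (y + w)) ∂heatMeasure n u := by
          rw [integral_sub (integrable_const _) h2, h3]
          simp
        rw [h4]
        refine le_trans (ENNReal.rpow_le_rpow (enorm_integral_le_lintegral_enorm _) hq0.le) ?_
        refine lintegral_rpow_le_of_isProbabilityMeasure hq.le ?_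
        exact (Continuous.enorm (by fun_prop)).measurable.aemeasurable
    _ = ∫⁻ w, ∫⁻ y, ‖heat u f y - heat (2 * u) f (y + w)‖ₑ ^ q ∂volume ∂heatMeasure n u :=
        lintegral_lintegral_swap (hm (fun p => heat u f p.1 - heat (2 * u) f (p.1 + p.2))
          (by fun_prop)).aemeasurable
    _ = ∫⁻ w, ∫⁻ z, ‖heat u f (z - w) - heat (2 * u) f z‖ₑ ^ q ∂volume ∂heatMeasure n u := by
        refine lintegral_congr fun w => ?_
        rw [← lintegral_add_right_eq_self (fun z =>
          ‖heat u f (z - w) - heat (2 * u) f z‖ₑ ^ q) w]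
        simp
    _ = _ := (lintegral_lintegral_swap (hm (fun p => heat u f (p.1 - p.2) - heat (2 * u) f p.1)
          (by fun_prop)).aemeasurable).symm

theorem tsum_eLpNorm_heat_sub_heat_le {q : ℝ} (hq : 1 < q) {T : ℝ} (hT : 0 < T)
    {f : EuclideanSpace ℝ (Fin n) → Y} (hf : MemLp f (ENNReal.ofReal q)) :
    ∑' k : ℕ, eLpNorm (heat (T / 2 ^ (k + 1)) f - heat (3 * (T / 2 ^ (k + 1))) f)
        (ENNReal.ofReal q) volume ^ q
      ≤ martingaleCotypeConst q Y ^ q * eLpNorm f (ENNReal.ofReal q) volume ^ q := by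
  have hq0 : 0 < q := one_pos.trans hq
  have hq1 : 1 ≤ ENNReal.ofReal q := by simpa using hq.le
  have hu : ∀ k : ℕ, 0 < T / 2 ^ k := fun k => by positivity
  have hdouble : ∀ k : ℕ, 2 * (T / 2 ^ (k + 1)) = T / 2 ^ k := fun k => by
    rw [pow_succ]; field_simp
  have : ∀ k : ℕ, IsProbabilityMeasure (heatMeasure n (T / 2 ^ (k + 1))) :=
    fun k => isProbabilityMeasure_heatMeasure (hu _)
  have key := tsum_lintegral_increment_le hq (g := fun k => heat (T / 2 ^ k) f)
    (γ := fun k => heatMeasure n (T / 2 ^ (k + 1)))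
    (fun k => (differentiable_heat hq1 (hu k) hf).continuous)
    (fun k z => by
      rw [← heat_eq_integral (hu _), heat_heat hq1 (hu _) (hu _) hf, ← two_mul, hdouble])
    (ENNReal.rpow_ne_top_of_nonneg hq0.le hf.2.ne)
    (fun k => by
      rw [← eLpNorm_ofReal_rpow hq0]
      gcongr
      exact eLpNorm_heat_le hq (hu k) hf.1)
  refine le_trans (ENNReal.tsum_le_tsum fun k => ?_) key
  simpa only [hdouble] using eLpNorm_heat_sub_heat_rpow_le hq (hu (k + 1)) hf

end HeatMartingale

/-! ### From dyadic sums to the scale-invariant measure `dt / t` -/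

section ScaleInvariance

lemma lintegral_eq_ofReal_mul_lintegral_comp_mul {c : ℝ} (hc : 0 < c) (F : ℝ → ℝ≥0∞) :
    ∫⁻ t, F t = ENNReal.ofReal c * ∫⁻ t, F (c * t) := by
  conv_lhs => rw [← Real.smul_map_volume_mul_left hc.ne', abs_of_pos hc]
  rw [lintegral_smul_measure, smul_eq_mul]
  congr 1
  exact (Homeomorph.mulLeft₀ c hc.ne').measurableEmbedding.lintegral_map F

lemma setLIntegral_div_comp_mul {c : ℝ} (hc : 0 < c) (G : ℝ → ℝ≥0∞) {S : Set ℝ}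
    (hS : MeasurableSet S) :
    ∫⁻ t in (c * ·) ⁻¹' S, G (c * t) / ENNReal.ofReal t = ∫⁻ t in S, G t / ENNReal.ofReal t := by
  rw [← lintegral_indicator hS, ← lintegral_indicator (hS.preimage (measurable_const_mul c)),
    lintegral_eq_ofReal_mul_lintegral_comp_mul hc (S.indicator _), ← lintegral_const_mul' _ _ ENNReal.ofReal_ne_top]
  refine lintegral_congr fun t => ?_
  by_cases ht : c * t ∈ S
  · rw [Set.indicator_of_mem ht, Set.indicator_of_mem (show t ∈ (c * ·) ⁻¹' S from ht),
      ENNReal.ofReal_mul hc.le, div_eq_mul_inv, div_eq_mul_inv,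
      ENNReal.mul_inv (.inr ENNReal.ofReal_ne_top) (.inl ENNReal.ofReal_ne_top), mul_left_comm,
      ← mul_assoc (ENNReal.ofReal c), ENNReal.mul_inv_cancel (by simpa using hc)
      ENNReal.ofReal_ne_top, one_mul]
  · rw [Set.indicator_of_notMem ht, Set.indicator_of_notMem (show t ∉ (c * ·) ⁻¹' S from ht),
      mul_zero]

lemma setLIntegral_Ioi_div_comp_mul {c : ℝ} (hc : 0 < c) (G : ℝ → ℝ≥0∞) :
    ∫⁻ t in Set.Ioi 0, G (c * t) / ENNReal.ofReal t
      = ∫⁻ t in Set.Ioi 0, G t / ENNReal.ofReal t := by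
  rw [← setLIntegral_div_comp_mul hc G measurableSet_Ioi]
  congr 2
  ext t
  simp [hc]

/-- A uniform bound for the sums over dyadic sequences bounds the integral against `dt / t`. -/
lemma setLIntegral_Ioi_div_le_of_tsum_le {G : ℝ → ℝ≥0∞} (hG : Measurable G) {A : ℝ≥0∞}
    (h : ∀ T : ℝ, 0 < T → ∑' k : ℕ, G (T / 2 ^ (k + 1)) ≤ A) :
    ∫⁻ t in Set.Ioi 0, G t / ENNReal.ofReal t ≤ A := by
  have hT : ∀ T : ℝ, 0 < T → ∫⁻ t in Set.Ioc 0 T, G t / ENNReal.ofReal t ≤ A := by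
    intro T hT
    have hcover : Set.Ioc 0 T ⊆ ⋃ k : ℕ, Set.Ioc (T / 2 ^ (k + 1)) (T / 2 ^ k) := by
      intro t ht
      obtain ⟨k, hk1, hk2⟩ := exists_nat_pow_near (x := T / t) (y := (2 : ℝ))
        ((one_le_div ht.1).2 ht.2) (by norm_num)
      refine Set.mem_iUnion.2 ⟨k, ?_, ?_⟩
      · rw [div_lt_iff₀ (by positivity)]
        rw [div_lt_iff₀ ht.1] at hk2
        linarith
      · rw [le_div_iff₀ (by positivity)]
        rw [le_div_iff₀ ht.1] at hk1
        linarith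
    calc ∫⁻ t in Set.Ioc 0 T, G t / ENNReal.ofReal t
        ≤ ∫⁻ t in ⋃ k : ℕ, Set.Ioc (T / 2 ^ (k + 1)) (T / 2 ^ k), G t / ENNReal.ofReal t :=
          lintegral_mono_set hcover
      _ ≤ ∑' k : ℕ, ∫⁻ t in Set.Ioc (T / 2 ^ (k + 1)) (T / 2 ^ k), G t / ENNReal.ofReal t :=
          lintegral_iUnion_le _ _
      _ = ∑' k : ℕ, ∫⁻ t in Set.Ioc (T / 2) T, G ((2 ^ k)⁻¹ * t) / ENNReal.ofReal t := by
          refine tsum_congr fun k => ?_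
          rw [← setLIntegral_div_comp_mul (c := (2 ^ k)⁻¹) (by positivity) G measurableSet_Ioc]
          congr 2
          ext t
          have h2 : (0 : ℝ) < 2 ^ k := by positivity
          simp only [Set.mem_preimage, Set.mem_Ioc, ← div_eq_inv_mul, pow_succ']
          rw [div_le_div_iff_of_pos_right h2, ← div_div, div_lt_div_iff_of_pos_right h2]
      _ = ∫⁻ t in Set.Ioc (T / 2) T, ∑' k : ℕ, G ((2 ^ k)⁻¹ * t) / ENNReal.ofReal t := by
          rw [lintegral_tsum]
          intro k
          exact ((hG.comp (measurable_const_mul _)).div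
            ENNReal.measurable_ofReal).aemeasurable
      -- The hypothesis is used at `2 * t`, whose dyadic sequence starts at `t`. Bounding `1 / t` by
      -- `2 / T` makes the block contribute `1` in place of `log 2`.
      _ ≤ ∫⁻ t in Set.Ioc (T / 2) T, A / ENNReal.ofReal (T / 2) := by
          refine setLIntegral_mono measurable_const fun t ht => ?_
          have ht0 : 0 < t := by have := ht.1; linarith
          simp_rw [div_eq_mul_inv]
          rw [ENNReal.tsum_mul_right]
          gcongr
          · convert! h (2 * t) (by positivity) using 4 with k
            rw [pow_succ]; field_simp
          · have := ht.1
            rw [← div_eq_mul_inv]; exact this.le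
      _ = A := by
          rw [setLIntegral_const, Real.volume_Ioc, show T - T / 2 = T / 2 by ring]
          exact ENNReal.div_mul_cancel (by simpa using hT) ENNReal.ofReal_ne_top
  have hmono : Monotone fun R : ℕ => Set.Ioc (0 : ℝ) (R + 1) := fun a b hab =>
    Set.Ioc_subset_Ioc_right (by gcongr)
  have huniv : ⋃ R : ℕ, Set.Ioc (0 : ℝ) (R + 1) = Set.Ioi 0 := by
    ext t
    simp only [Set.mem_iUnion, Set.mem_Ioc, Set.mem_Ioi]
    refine ⟨fun ⟨_, h⟩ => h.1, fun h => ?_⟩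
    obtain ⟨R, hR⟩ := exists_nat_gt t
    exact ⟨R, h, by linarith⟩
  rw [← huniv, setLIntegral_iUnion_of_directed _ hmono.directed_le]
  exact iSup_le fun R => hT _ (by positivity)

/-- The measure `dt / t` on `(0, ∞)`. -/
noncomputable def scaleMeasure : Measure ℝ :=
  (volume.restrict (Set.Ioi 0)).withDensity fun t => (ENNReal.ofReal t)⁻¹

instance : SigmaFinite scaleMeasure := by
  refine SigmaFinite.withDensity_of_ne_top ?_
  filter_upwards [ae_restrict_mem measurableSet_Ioi] with t ht
  simpa using ht

lemma lintegral_scaleMeasure (G : ℝ → ℝ≥0∞) :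
    ∫⁻ t, G t ∂scaleMeasure = ∫⁻ t in Set.Ioi 0, G t / ENNReal.ofReal t := by
  rw [scaleMeasure, lintegral_withDensity_eq_lintegral_mul_non_measurable _ (by fun_prop)]
  · refine lintegral_congr fun t => ?_
    rw [Pi.mul_apply, mul_comm, div_eq_mul_inv]
  · filter_upwards [ae_restrict_mem measurableSet_Ioi] with t ht
    simpa using ht

end ScaleInvariance

/-! ### The square function estimate for first order operators -/

section LittlewoodPaley

variable {n : ℕ} {Y : Type*} [NormedAddCommGroup Y] [NormedSpace ℝ Y] {ι : Type*} [Fintype ι]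

/-- The combination `∑ⱼ ⟪w, vⱼ⟫ fⱼ`. -/
noncomputable def innerComb (v : ι → EuclideanSpace ℝ (Fin n))
    (f : ι → EuclideanSpace ℝ (Fin n) → Y) (w x : EuclideanSpace ℝ (Fin n)) : Y :=
  ∑ j, (inner ℝ w (v j) : ℝ) • f j x

lemma memLp_innerComb {p : ℝ≥0∞} (v : ι → EuclideanSpace ℝ (Fin n))
    {f : ι → EuclideanSpace ℝ (Fin n) → Y} (hf : ∀ j, MemLp (f j) p)
    (w : EuclideanSpace ℝ (Fin n)) : MemLp (innerComb v f w) p := by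
  unfold innerComb
  exact memLp_finsetSum _ fun j _ => (hf j).const_smul _

lemma innerComb_smul (v : ι → EuclideanSpace ℝ (Fin n))
    (f : ι → EuclideanSpace ℝ (Fin n) → Y) (r : ℝ) (w : EuclideanSpace ℝ (Fin n)) :
    innerComb v f (r • w) = r • innerComb v f w := by
  ext x
  simp [innerComb, inner_smul_left, Finset.smul_sum, smul_smul]

lemma eLpNorm_innerComb_smul (v : ι → EuclideanSpace ℝ (Fin n))
    (f : ι → EuclideanSpace ℝ (Fin n) → Y) (p : ℝ≥0∞) (r : ℝ) (w : EuclideanSpace ℝ (Fin n)) :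
    eLpNorm (innerComb v f (r • w)) p volume = ‖r‖ₑ * eLpNorm (innerComb v f w) p volume := by
  rw [innerComb_smul, eLpNorm_const_smul]

/-- Finiteness makes the remainder of the telescoping sum tend to zero. -/
lemma lintegral_eLpNorm_innerComb_ne_top {p : ℝ≥0∞} (hp : 1 ≤ p)
    (v : ι → EuclideanSpace ℝ (Fin n)) {f : ι → EuclideanSpace ℝ (Fin n) → Y}
    (hf : ∀ j, MemLp (f j) p) :
    ∫⁻ w, eLpNorm (innerComb v f w) p volume ∂heatMeasure n 1 ≠ ∞ := by
  refine ne_top_of_le_ne_top (b := ∑ j, 7 * ‖v j‖ₑ * eLpNorm (f j) p volume) ?_ ?_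
  · exact (ENNReal.sum_lt_top.2 fun j _ => ENNReal.mul_lt_top
      (ENNReal.mul_lt_top (by simp) enorm_lt_top) (hf j).2).ne
  calc ∫⁻ w, eLpNorm (innerComb v f w) p volume ∂heatMeasure n 1
      ≤ ∫⁻ w, ∑ j, ‖(inner ℝ w (v j) : ℝ)‖ₑ * eLpNorm (f j) p volume ∂heatMeasure n 1 := by
        refine lintegral_mono fun w => ?_
        have : innerComb v f w = ∑ j, (inner ℝ w (v j) : ℝ) • f j := by
          ext x; simp [innerComb]
        rw [this]
        refine (eLpNorm_sum_le (fun j _ => (hf j).1.const_smul _) hp).trans ?_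
        refine Finset.sum_le_sum fun j _ => ?_
        rw [eLpNorm_const_smul]
    _ ≤ _ := by
        rw [lintegral_finsetSum _ (by fun_prop)]
        refine Finset.sum_le_sum fun j _ => ?_
        rw [lintegral_mul_const _ (by fun_prop)]
        gcongr
        exact lintegral_enorm_inner_heatMeasure_le (v j)

/-- The first order operator `∑ⱼ ∂_{vⱼ}`, applied to the heat evolutes of `f`. -/
noncomputable def heatDeriv (v : ι → EuclideanSpace ℝ (Fin n))
    (f : ι → EuclideanSpace ℝ (Fin n) → Y) (t : ℝ) (x : EuclideanSpace ℝ (Fin n)) : Y :=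
  ∑ j, lineDeriv ℝ (heat t (f j)) x (v j)

/-- Joint measurability in `(w, x)` requires strongly measurable representatives; `w` enters only
through the coefficients, so one null set serves all `w`. -/
lemma exists_stronglyMeasurable_innerComb (v : ι → EuclideanSpace ℝ (Fin n))
    {f : ι → EuclideanSpace ℝ (Fin n) → Y} (hf : ∀ j, AEStronglyMeasurable (f j)) :
    ∃ f' : ι → EuclideanSpace ℝ (Fin n) → Y, (∀ j, StronglyMeasurable (f' j)) ∧
      ∀ w, innerComb v f w =ᵐ[volume] innerComb v f' w := by
  refine ⟨fun j => (hf j).mk (f j), fun j => (hf j).stronglyMeasurable_mk, fun w => ?_⟩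
  have : ∀ᵐ x ∂(volume : Measure (EuclideanSpace ℝ (Fin n))), ∀ j, f j x = (hf j).mk (f j) x :=
    ae_all_iff.2 fun j => (hf j).ae_eq_mk
  filter_upwards [this] with x hx
  simp [innerComb, hx]

lemma measurable_eLpNorm_innerComb {q : ℝ} (hq : 0 < q)
    (v : ι → EuclideanSpace ℝ (Fin n)) {f : ι → EuclideanSpace ℝ (Fin n) → Y}
    (hf : ∀ j, AEStronglyMeasurable (f j)) :
    Measurable fun w => eLpNorm (innerComb v f w) (ENNReal.ofReal q) volume := by
  obtain ⟨f', hf's, heq⟩ := exists_stronglyMeasurable_innerComb v hf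
  simp_rw [eLpNorm_congr_ae (heq _), eLpNorm_eq_lintegral_rpow_enorm_toReal
    (show ENNReal.ofReal q ≠ 0 by simpa using hq) ENNReal.ofReal_ne_top]
  have hs : StronglyMeasurable fun p : EuclideanSpace ℝ (Fin n) × EuclideanSpace ℝ (Fin n) =>
      innerComb v f' p.1 p.2 := by
    unfold innerComb
    refine Finset.stronglyMeasurable_fun_sum _ fun j _ => StronglyMeasurable.smul
      (Measurable.stronglyMeasurable (by fun_prop)) ((hf's j).comp_measurable measurable_snd)
  refine Measurable.pow_const ?_ _
  exact Measurable.lintegral_prod_right (hs.enorm.pow_const _)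

lemma measurable_eLpNorm_heat_sub_heat_innerComb {q : ℝ} (hq : 0 < q)
    (v : ι → EuclideanSpace ℝ (Fin n)) {f : ι → EuclideanSpace ℝ (Fin n) → Y}
    (hf : ∀ j, AEStronglyMeasurable (f j)) :
    Measurable fun p : ℝ × EuclideanSpace ℝ (Fin n) =>
      eLpNorm (heat p.1 (innerComb v f p.2) - heat (3 * p.1) (innerComb v f p.2))
        (ENNReal.ofReal q) volume := by
  obtain ⟨f', hf's, heq⟩ := exists_stronglyMeasurable_innerComb v hf
  have hr : ∀ t w, heat t (innerComb v f w) = heat t (innerComb v f' w) :=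
    fun t w => heat_congr_ae (heq w)
  simp_rw [hr, eLpNorm_eq_lintegral_rpow_enorm_toReal (show ENNReal.ofReal q ≠ 0 by simpa using hq)
    ENNReal.ofReal_ne_top]
  have hheat : StronglyMeasurable
      fun p : (ℝ × EuclideanSpace ℝ (Fin n)) × EuclideanSpace ℝ (Fin n) =>
        heat p.1.1 (innerComb v f' p.1.2) p.2 := by
    unfold heat innerComb
    refine StronglyMeasurable.integral_prod_right
      (f := fun (p : (ℝ × EuclideanSpace ℝ (Fin n)) × EuclideanSpace ℝ (Fin n))
        (z : EuclideanSpace ℝ (Fin n)) =>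
        heatKernel p.1.1 z • ∑ j, (inner ℝ p.1.2 (v j) : ℝ) • f' j (p.2 - z)) ?_
    unfold Function.uncurry
    refine StronglyMeasurable.smul ?_ (Finset.stronglyMeasurable_fun_sum _ fun j _ => ?_)
    · exact (measurable_heatKernel_uncurry.comp (by fun_prop :
        Measurable fun a : ((ℝ × EuclideanSpace ℝ (Fin n)) × EuclideanSpace ℝ (Fin n)) ×
          EuclideanSpace ℝ (Fin n) => (a.1.1.1, a.2))).stronglyMeasurable
    · refine StronglyMeasurable.smul (Measurable.stronglyMeasurable (by fun_prop)) ?_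
      exact (hf's j).comp_measurable (by fun_prop)
  have hheat3 : StronglyMeasurable
      fun p : (ℝ × EuclideanSpace ℝ (Fin n)) × EuclideanSpace ℝ (Fin n) =>
        heat (3 * p.1.1) (innerComb v f' p.1.2) p.2 :=
    hheat.comp_measurable (g := fun p : (ℝ × EuclideanSpace ℝ (Fin n)) × EuclideanSpace ℝ (Fin n) =>
      ((3 * p.1.1, p.1.2), p.2)) (by fun_prop)
  refine Measurable.pow_const ?_ _
  exact Measurable.lintegral_prod_right ((hheat.sub hheat3).enorm.pow_const _)

/-- The semigroup law `H_a (H_a - H_{3a}) = H_{2a} - H_{4a}` turns the differences controlled by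
cotype into a dyadic increment of the derivative. -/
lemma heatDeriv_heat_sub {q : ℝ} (hq : 1 < q) (v : ι → EuclideanSpace ℝ (Fin n))
    {f : ι → EuclideanSpace ℝ (Fin n) → Y} (hf : ∀ j, MemLp (f j) (ENNReal.ofReal q))
    {a : ℝ} (ha : 0 < a) :
    heatDeriv v (fun j => heat a (f j) - heat (3 * a) (f j)) a
      = heatDeriv v f (2 * a) - heatDeriv v f (2 * (2 * a)) := by
  have hq1 : 1 ≤ ENNReal.ofReal q := by simpa using hq.le
  have ha3 : 0 < 3 * a := by positivity
  ext x
  simp only [heatDeriv, Pi.sub_apply, ← Finset.sum_sub_distrib]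
  refine Finset.sum_congr rfl fun j _ => ?_
  rw [heat_sub hq1 ha (memLp_heat hq ha (hf j)) (memLp_heat hq ha3 (hf j)),
    heat_heat hq1 ha ha (hf j), heat_heat hq1 ha ha3 (hf j), ← two_mul,
    show a + 3 * a = 2 * (2 * a) by ring]
  have d1 := differentiable_heat hq1 (t := 2 * a) (by positivity) (hf j) x
  have d2 := differentiable_heat hq1 (t := 2 * (2 * a)) (by positivity) (hf j) x
  rw [(d1.sub d2).lineDeriv_eq_fderiv, d1.lineDeriv_eq_fderiv, d2.lineDeriv_eq_fderiv,
    fderiv_sub d1 d2, sub_apply]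

variable [CompleteSpace Y]

lemma heatDeriv_eq {p : ℝ≥0∞} (hp : 1 ≤ p) (v : ι → EuclideanSpace ℝ (Fin n))
    {f : ι → EuclideanSpace ℝ (Fin n) → Y} (hf : ∀ j, MemLp (f j) p) {t : ℝ} (ht : 0 < t) :
    heatDeriv v f t = (-(1 / (2 * t))) •
      fun x => ∫ w, ∑ j, (inner ℝ w (v j) : ℝ) • f j (x - w) ∂heatMeasure n t := by
  ext x
  simp only [heatDeriv, Pi.smul_apply]
  rw [integral_finsetSum _ fun j _ => integrable_inner_smul_translate hp ht (hf j) x (v j),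
    Finset.smul_sum]
  exact Finset.sum_congr rfl fun j _ => lineDeriv_heat hp ht (hf j) x (v j)

lemma aestronglyMeasurable_heatDeriv {p : ℝ≥0∞} (hp : 1 ≤ p) (v : ι → EuclideanSpace ℝ (Fin n))
    {f : ι → EuclideanSpace ℝ (Fin n) → Y} (hf : ∀ j, MemLp (f j) p) {t : ℝ} (ht : 0 < t) :
    AEStronglyMeasurable (heatDeriv v f t) := by
  have := isProbabilityMeasure_heatMeasure (n := n) ht
  rw [heatDeriv_eq hp v hf ht]
  refine AEStronglyMeasurable.const_smul (AEStronglyMeasurable.integral_prod_right'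
    (f := fun p : EuclideanSpace ℝ (Fin n) × EuclideanSpace ℝ (Fin n) =>
      ∑ j, (inner ℝ p.2 (v j) : ℝ) • f j (p.1 - p.2)) ?_) _
  refine Finset.aestronglyMeasurable_fun_sum _ fun j _ => AEStronglyMeasurable.smul
    (Measurable.aestronglyMeasurable (by fun_prop))
    (aestronglyMeasurable_comp_sub (hf j).1 _)

/-- The derivative is `-1 / (2t)` times a Gaussian average with linear weights. Minkowski moves the
norm inside, and rescaling `w` by `√t` brings the Gaussian to time 1, leaving `√t / (2t)`. -/
lemma eLpNorm_heatDeriv_le {q : ℝ} (hq : 1 < q) (v : ι → EuclideanSpace ℝ (Fin n))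
    {f : ι → EuclideanSpace ℝ (Fin n) → Y} (hf : ∀ j, MemLp (f j) (ENNReal.ofReal q))
    {t : ℝ} (ht : 0 < t) :
    eLpNorm (heatDeriv v f t) (ENNReal.ofReal q) volume ≤ ENNReal.ofReal (1 / (2 * √t)) *
      ∫⁻ w, eLpNorm (innerComb v f w) (ENNReal.ofReal q) volume ∂heatMeasure n 1 := by
  have := isProbabilityMeasure_heatMeasure (n := n) ht
  have hs : 0 < √t := Real.sqrt_pos.2 ht
  have hmap : heatMeasure n t = (heatMeasure n 1).map (fun w => √t • w) := by
    rw [map_smul_heatMeasure one_pos hs.ne', Real.sq_sqrt ht.le, mul_one]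
  rw [heatDeriv_eq (by simpa using hq.le) v hf ht, eLpNorm_const_smul]
  calc ‖-(1 / (2 * t))‖ₑ * eLpNorm (fun x => ∫ w, ∑ j, (inner ℝ w (v j) : ℝ) • f j (x - w)
          ∂heatMeasure n t) (ENNReal.ofReal q) volume
      ≤ ‖-(1 / (2 * t))‖ₑ *
          ∫⁻ w, eLpNorm (innerComb v f w) (ENNReal.ofReal q) volume ∂heatMeasure n t := by
        gcongr
        exact eLpNorm_integral_sum_smul_translate_le hq (heatMeasure n t)
          (c := fun w j => inner ℝ w (v j)) (by fun_prop) fun j => (hf j).1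
    _ = ‖-(1 / (2 * t))‖ₑ * (ENNReal.ofReal √t *
          ∫⁻ w, eLpNorm (innerComb v f w) (ENNReal.ofReal q) volume ∂heatMeasure n 1) := by
        congr 1
        rw [hmap, lintegral_map (measurable_eLpNorm_innerComb (one_pos.trans hq) v
          fun j => (hf j).1) (measurable_const_smul _),
          ← lintegral_const_mul' _ _ ENNReal.ofReal_ne_top]
        refine lintegral_congr fun w => ?_
        rw [← Real.enorm_eq_ofReal hs.le]
        exact eLpNorm_innerComb_smul v f _ _ w
    _ = _ := by
        rw [← mul_assoc, enorm_neg, Real.enorm_eq_ofReal (by positivity),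
          ← ENNReal.ofReal_mul (by positivity)]
        congr 2
        have := Real.mul_self_sqrt ht.le
        field_simp
        linarith

lemma eLpNorm_heatDeriv_sub_le {q : ℝ} (hq : 1 < q) (v : ι → EuclideanSpace ℝ (Fin n))
    {f : ι → EuclideanSpace ℝ (Fin n) → Y} (hf : ∀ j, MemLp (f j) (ENNReal.ofReal q))
    {a : ℝ} (ha : 0 < a) :
    eLpNorm (heatDeriv v f (2 * a) - heatDeriv v f (2 * (2 * a))) (ENNReal.ofReal q) volume
      ≤ ENNReal.ofReal (1 / (2 * √a)) * ∫⁻ w, eLpNorm (heat a (innerComb v f w)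
        - heat (3 * a) (innerComb v f w)) (ENNReal.ofReal q) volume ∂heatMeasure n 1 := by
  have hq1 : 1 ≤ ENNReal.ofReal q := by simpa using hq.le
  have ha3 : 0 < 3 * a := by positivity
  rw [← heatDeriv_heat_sub hq v hf ha]
  refine (eLpNorm_heatDeriv_le hq v (fun j =>
    (memLp_heat hq ha (hf j)).sub (memLp_heat hq ha3 (hf j))) ha).trans_eq ?_
  congr 1
  refine lintegral_congr fun w => ?_
  congr 1
  unfold innerComb
  rw [heat_sum_smul hq1 ha hf, heat_sum_smul hq1 ha3 hf]
  ext x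
  simp [smul_sub]

/-- Telescoping along the times `2 ^ K * t`; the remainder is `O((2 ^ K * t) ^ (-1/2))` and
disappears in the limit. -/
lemma eLpNorm_heatDeriv_le_tsum {q : ℝ} (hq : 1 < q) (v : ι → EuclideanSpace ℝ (Fin n))
    {f : ι → EuclideanSpace ℝ (Fin n) → Y} (hf : ∀ j, MemLp (f j) (ENNReal.ofReal q))
    {t : ℝ} (ht : 0 < t) :
    eLpNorm (heatDeriv v f t) (ENNReal.ofReal q) volume ≤
      ∑' k : ℕ, ENNReal.ofReal (1 / (2 * √(2 ^ k / 2 * t))) *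
        ∫⁻ w, eLpNorm (heat (2 ^ k / 2 * t) (innerComb v f w)
          - heat (3 * (2 ^ k / 2 * t)) (innerComb v f w)) (ENNReal.ofReal q) volume
            ∂heatMeasure n 1 := by
  have hq1 : 1 ≤ ENNReal.ofReal q := by simpa using hq.le
  set b : ℕ → ℝ≥0∞ := fun k => ENNReal.ofReal (1 / (2 * √(2 ^ k / 2 * t))) *
        ∫⁻ w, eLpNorm (heat (2 ^ k / 2 * t) (innerComb v f w)
          - heat (3 * (2 ^ k / 2 * t)) (innerComb v f w)) (ENNReal.ofReal q) volume
            ∂heatMeasure n 1 with hb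
  set I := ∫⁻ w, eLpNorm (innerComb v f w) (ENNReal.ofReal q) volume ∂heatMeasure n 1 with hI
  have hIfin : I ≠ ∞ := lintegral_eLpNorm_innerComb_ne_top hq1 v hf
  have hstep : ∀ K : ℕ, eLpNorm (heatDeriv v f t) (ENNReal.ofReal q) volume
      ≤ ∑ k ∈ Finset.range K, b k
        + eLpNorm (heatDeriv v f (2 ^ K * t)) (ENNReal.ofReal q) volume := by
    intro K
    induction K with
    | zero => simp
    | succ K ih =>
      refine ih.trans ?_
      rw [Finset.sum_range_succ, add_assoc]
      gcongr
      have hK : 0 < 2 ^ K / 2 * t := by positivity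
      have h1 := eLpNorm_heatDeriv_sub_le hq v hf hK
      have e1 : 2 * (2 ^ K / 2 * t) = 2 ^ K * t := by ring
      have e2 : 2 * (2 ^ K * t) = 2 ^ (K + 1) * t := by ring
      rw [e1, e2] at h1
      have m1 := aestronglyMeasurable_heatDeriv hq1 v hf (t := 2 ^ K * t) (by positivity)
      have m2 := aestronglyMeasurable_heatDeriv hq1 v hf (t := 2 ^ (K + 1) * t) (by positivity)
      calc eLpNorm (heatDeriv v f (2 ^ K * t)) (ENNReal.ofReal q) volume
          = eLpNorm ((heatDeriv v f (2 ^ K * t) - heatDeriv v f (2 ^ (K + 1) * t))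
              + heatDeriv v f (2 ^ (K + 1) * t)) (ENNReal.ofReal q) volume := by
            rw [sub_add_cancel]
        _ ≤ _ := eLpNorm_add_le (m1.sub m2) m2 hq1
        _ ≤ _ := by gcongr
  have hlim : Filter.Tendsto (fun K : ℕ => ∑' k, b k + ENNReal.ofReal (1 / (2 * √(2 ^ K * t))) * I)
      Filter.atTop (nhds (∑' k, b k + 0 * I)) := by
    refine tendsto_const_nhds.add (ENNReal.Tendsto.mul_const ?_ (.inr hIfin))
    rw [← ENNReal.ofReal_zero]
    refine ENNReal.tendsto_ofReal (tendsto_const_nhds.div_atTop ?_)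
    refine Filter.Tendsto.const_mul_atTop two_pos (Real.tendsto_sqrt_atTop.comp ?_)
    exact (tendsto_pow_atTop_atTop_of_one_lt one_lt_two).atTop_mul_const ht
  rw [zero_mul, add_zero] at hlim
  refine ge_of_tendsto' hlim fun K => (hstep K).trans ?_
  gcongr
  · exact ENNReal.sum_le_tsum _
  · exact eLpNorm_heatDeriv_le hq v hf (by positivity)

lemma eLpNorm_sqrt_smul_heatDeriv_le {q : ℝ} (hq : 1 < q) (v : ι → EuclideanSpace ℝ (Fin n))
    {f : ι → EuclideanSpace ℝ (Fin n) → Y} (hf : ∀ j, MemLp (f j) (ENNReal.ofReal q))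
    {t : ℝ} (ht : 0 < t) :
    eLpNorm (fun x => √t • heatDeriv v f t x) (ENNReal.ofReal q) volume ≤
      ∑' k : ℕ, ENNReal.ofReal ((1 / √2) ^ (k + 1)) *
        ∫⁻ w, eLpNorm (heat (2 ^ k / 2 * t) (innerComb v f w)
          - heat (3 * (2 ^ k / 2 * t)) (innerComb v f w)) (ENNReal.ofReal q) volume
            ∂heatMeasure n 1 := by
  have h1 : (fun x => √t • heatDeriv v f t x) = √t • heatDeriv v f t := rfl
  rw [h1, eLpNorm_const_smul]
  refine (mul_le_mul_right (eLpNorm_heatDeriv_le_tsum hq v hf ht) _).trans_eq ?_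
  rw [← ENNReal.tsum_mul_left]
  refine tsum_congr fun k => ?_
  rw [← mul_assoc, Real.enorm_eq_ofReal (Real.sqrt_nonneg t),
    ← ENNReal.ofReal_mul (Real.sqrt_nonneg t)]
  congr 2
  -- With `a = 2 ^ k / 2 * t` the weight is `√t / (2√a) = 2 ^ (-(k + 1) / 2)`, independent of `t`.
  have hs : 0 < √t := Real.sqrt_pos.2 ht
  have hk : √((2 : ℝ) ^ k) = √2 ^ k := by
    rw [Real.sqrt_eq_iff_mul_self_eq (by positivity) (by positivity), ← mul_pow,
      Real.mul_self_sqrt (by norm_num)]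
  rw [Real.sqrt_mul (by positivity), Real.sqrt_div (by positivity), hk]
  have h2 := Real.sq_sqrt (show (0 : ℝ) ≤ 2 by norm_num)
  rw [one_div_pow, pow_succ]
  field_simp
  linarith

lemma tsum_inv_sqrt_two_pow_le :
    ∑' k : ℕ, ENNReal.ofReal ((1 / √2) ^ (k + 1)) ≤ 3 := by
  have h0 : (0 : ℝ) ≤ 1 / √2 := by positivity
  have h2 : (7 / 5 : ℝ) < √2 := Real.lt_sqrt_of_sq_lt (by norm_num)
  have h1 : 1 / √2 < 5 / 7 := by
    rw [div_lt_div_iff₀ (by positivity) (by norm_num)]; linarith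
  have hs : Summable fun k : ℕ => (1 / √2) ^ (k + 1) :=
    (summable_nat_add_iff 1).2 (summable_geometric_of_lt_one h0 (by linarith))
  rw [← ENNReal.ofReal_tsum_of_nonneg (fun k => by positivity) hs]
  simp_rw [pow_succ]
  rw [tsum_mul_right, tsum_geometric_of_lt_one h0 (by linarith), ← ENNReal.ofReal_ofNat]
  refine ENNReal.ofReal_le_ofReal ?_
  rw [inv_mul_le_iff₀ (by linarith)]
  linarith

/-- The square function estimate for `∑ⱼ ∂_{vⱼ} H_t fⱼ`. -/
theorem lintegral_sqrt_smul_heatDeriv_le {q : ℝ} (hq : 1 < q)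
    (v : ι → EuclideanSpace ℝ (Fin n)) {f : ι → EuclideanSpace ℝ (Fin n) → Y}
    (hf : ∀ j, MemLp (f j) (ENNReal.ofReal q)) :
    (∫⁻ t in Set.Ioi (0 : ℝ), eLpNorm (fun x => √t • heatDeriv v f t x) (ENNReal.ofReal q)
        volume ^ q / ENNReal.ofReal t) ^ (1 / q)
      ≤ 3 * martingaleCotypeConst q Y *
        ∫⁻ w, eLpNorm (innerComb v f w) (ENNReal.ofReal q) volume ∂heatMeasure n 1 := by
  have hq0 : 0 < q := one_pos.trans hq
  have hq1 : 1 ≤ ENNReal.ofReal q := by simpa using hq.le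
  have := isProbabilityMeasure_heatMeasure (n := n) one_pos
  set φ : ℝ → EuclideanSpace ℝ (Fin n) → ℝ≥0∞ := fun t w =>
    eLpNorm (heat t (innerComb v f w) - heat (3 * t) (innerComb v f w))
      (ENNReal.ofReal q) volume with hφ
  have hφm : Measurable (Function.uncurry φ) :=
    measurable_eLpNorm_heat_sub_heat_innerComb hq0 v fun j => (hf j).1
  set Φ : ℝ → ℝ≥0∞ := fun t => ∫⁻ w, φ t w ∂heatMeasure n 1 with hΦ
  have hΦm : Measurable Φ := hφm.lintegral_prod_right
  set b : ℕ → ℝ≥0∞ := fun k => ENNReal.ofReal ((1 / √2) ^ (k + 1)) with hb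
  have hscale : ∀ k : ℕ, ∫⁻ t, Φ (2 ^ k / 2 * t) ^ q ∂scaleMeasure
      = ∫⁻ t, Φ t ^ q ∂scaleMeasure := fun k => by
    rw [lintegral_scaleMeasure, lintegral_scaleMeasure]
    exact setLIntegral_Ioi_div_comp_mul (by positivity) fun t => Φ t ^ q
  -- For fixed `w` the combination is a single `L_q` function, to which the scalar-free semigroup
  -- bound applies.
  have hw : ∀ w, (∫⁻ t, φ t w ^ q ∂scaleMeasure) ^ (1 / q)
      ≤ martingaleCotypeConst q Y * eLpNorm (innerComb v f w) (ENNReal.ofReal q) volume := by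
    intro w
    rw [one_div, ENNReal.rpow_inv_le_iff hq0, ENNReal.mul_rpow_of_nonneg _ _ hq0.le,
      lintegral_scaleMeasure]
    exact setLIntegral_Ioi_div_le_of_tsum_le (G := fun t => φ t w ^ q)
      ((hφm.comp measurable_prodMk_right).pow_const q)
      fun T hT => tsum_eLpNorm_heat_sub_heat_le hq hT (memLp_innerComb v hf w)
  calc (∫⁻ t in Set.Ioi (0 : ℝ), eLpNorm (fun x => √t • heatDeriv v f t x) (ENNReal.ofReal q)
        volume ^ q / ENNReal.ofReal t) ^ (1 / q)
      ≤ (∫⁻ t in Set.Ioi (0 : ℝ), (∑' k, b k * Φ (2 ^ k / 2 * t)) ^ q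
          / ENNReal.ofReal t) ^ (1 / q) := by
        gcongr ?_ ^ _
        refine setLIntegral_mono' measurableSet_Ioi fun t ht => ?_
        gcongr
        exact eLpNorm_sqrt_smul_heatDeriv_le hq v hf ht
    _ = (∫⁻ t, (∑' k, b k * Φ (2 ^ k / 2 * t)) ^ q ∂scaleMeasure) ^ (1 / q) := by
        rw [lintegral_scaleMeasure]
    -- Minkowski over `k`: dilation by `2 ^ k / 2` preserves `dt / t`, so only the geometric sum of
    -- the weights remains. A second use moves the average over `w` outside.
    _ ≤ ∑' k, (∫⁻ t, (b k * Φ (2 ^ k / 2 * t)) ^ q ∂scaleMeasure) ^ (1 / q) :=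
        lintegral_rpow_tsum_le hq fun k =>
          (hΦm.comp (measurable_const_mul _)).const_mul _
    _ = ∑' k, b k * (∫⁻ t, Φ t ^ q ∂scaleMeasure) ^ (1 / q) := by
        refine tsum_congr fun k => ?_
        simp_rw [ENNReal.mul_rpow_of_nonneg _ _ hq0.le]
        rw [lintegral_const_mul' _ _ (ENNReal.rpow_ne_top_of_nonneg hq0.le ENNReal.ofReal_ne_top),
          ENNReal.mul_rpow_of_nonneg _ _ (by positivity), ← ENNReal.rpow_mul,
          mul_one_div_cancel hq0.ne', ENNReal.rpow_one, hscale]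
    _ ≤ 3 * ∫⁻ w, (∫⁻ t, φ t w ^ q ∂scaleMeasure) ^ (1 / q) ∂heatMeasure n 1 := by
        rw [ENNReal.tsum_mul_right]
        gcongr
        · exact tsum_inv_sqrt_two_pow_le
        · exact lintegral_rpow_lintegral_le_of_measurable hq hφm
    _ ≤ 3 * ∫⁻ w, martingaleCotypeConst q Y *
          eLpNorm (innerComb v f w) (ENNReal.ofReal q) volume ∂heatMeasure n 1 := by
        gcongr with w
        exact hw w
    _ = _ := by
        rw [lintegral_const_mul _ (measurable_eLpNorm_innerComb hq0 v fun j => (hf j).1), mul_assoc]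

end LittlewoodPaley

/-! ### From Gaussian averages to spherical averages -/

section Polar

variable {n : ℕ}

lemma lintegral_eq_lintegral_sphere_prod (hn : 1 ≤ n)
    (G : EuclideanSpace ℝ (Fin n) → ℝ≥0∞) :
    ∫⁻ w, G w = ∫⁻ p : Metric.sphere (0 : EuclideanSpace ℝ (Fin n)) 1 × Set.Ioi (0 : ℝ),
      G (p.2.1 • p.1.1) ∂((volume : Measure (EuclideanSpace ℝ (Fin n))).toSphere.prod
        (Measure.volumeIoiPow (Module.finrank ℝ (EuclideanSpace ℝ (Fin n)) - 1))) := by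
  have : Nonempty (Fin n) := ⟨⟨0, hn⟩⟩
  have : Nontrivial (EuclideanSpace ℝ (Fin n)) := inferInstance
  rw [← (volume : Measure (EuclideanSpace ℝ (Fin n))).measurePreserving_homeomorphUnitSphereProd
    |>.lintegral_comp_emb (Homeomorph.measurableEmbedding _)]
  conv_lhs => rw [← restrict_compl_singleton (μ := volume) (0 : EuclideanSpace ℝ (Fin n)),
    ← lintegral_subtype_comap (measurableSet_singleton _).compl]
  refine lintegral_congr fun x => ?_
  congr 1
  have hx : ‖x.1‖ ≠ 0 := norm_ne_zero_iff.2 x.2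
  simp [smul_smul, hx]

/-- A function homogeneous of degree one integrates against a radial weight like its spherical
average times the norm. -/
lemma lintegral_radial_mul_homogeneous (hn : 1 ≤ n) {F : ℝ → ℝ≥0∞} (hF : Measurable F)
    {N : EuclideanSpace ℝ (Fin n) → ℝ≥0∞} (hN : Measurable N)
    (hhom : ∀ (r : ℝ) w, N (r • w) = ‖r‖ₑ * N w) :
    ∫⁻ w, F ‖w‖ * N w = (∫⁻ w : EuclideanSpace ℝ (Fin n), F ‖w‖ * ‖w‖ₑ) *
      ⨍⁻ σ : Metric.sphere (0 : EuclideanSpace ℝ (Fin n)) 1, N σ.1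
        ∂(volume : Measure (EuclideanSpace ℝ (Fin n))).toSphere := by
  have : Nonempty (Fin n) := ⟨⟨0, hn⟩⟩
  have : Nontrivial (EuclideanSpace ℝ (Fin n)) := inferInstance
  set S := (volume : Measure (EuclideanSpace ℝ (Fin n))).toSphere with hS
  set C := ∫⁻ r : Set.Ioi (0 : ℝ), F r.1 * ‖r.1‖ₑ
    ∂Measure.volumeIoiPow (Module.finrank ℝ (EuclideanSpace ℝ (Fin n)) - 1) with hC
  -- The radial constant `C` is the same for every homogeneous `M`; comparing `N` with the norm
  -- eliminates it without computing it.
  have key : ∀ M : EuclideanSpace ℝ (Fin n) → ℝ≥0∞, Measurable M →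
      (∀ (r : ℝ) w, M (r • w) = ‖r‖ₑ * M w) →
      ∫⁻ w, F ‖w‖ * M w = (∫⁻ σ, M σ.1 ∂S) * C := by
    intro M hM hMh
    rw [lintegral_eq_lintegral_sphere_prod hn, hC, ← lintegral_prod_mul]
    · refine lintegral_congr fun p => ?_
      have hp : ‖p.2.1 • p.1.1‖ = p.2.1 := by
        rw [norm_smul, norm_eq_of_mem_sphere, mul_one, Real.norm_of_nonneg (le_of_lt p.2.2)]
      rw [hp, hMh]
      ring
    · exact (hM.comp measurable_subtype_coe).aemeasurable
    · exact ((hF.comp measurable_subtype_coe).mul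
        (measurable_subtype_coe.enorm)).aemeasurable
  have h1 : ∫⁻ σ : Metric.sphere (0 : EuclideanSpace ℝ (Fin n)) 1, ‖σ.1‖ₑ ∂S = S Set.univ := by
    have : ∀ σ : Metric.sphere (0 : EuclideanSpace ℝ (Fin n)) 1, ‖σ.1‖ₑ = 1 := fun σ => by
      rw [← ofReal_norm, norm_eq_of_mem_sphere, ENNReal.ofReal_one]
    simp_rw [this]
    simp
  have hS0 : S Set.univ ≠ 0 := by
    rw [Ne, Measure.measure_univ_eq_zero]
    exact Measure.toSphere_ne_zero _
  rw [key N hN hhom, key (fun w => ‖w‖ₑ) (by fun_prop) (fun r w => enorm_smul r w), h1,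
    laverage_eq, mul_comm (S Set.univ), mul_assoc, ENNReal.mul_div_cancel hS0 (measure_ne_top _ _),
    mul_comm]

lemma lintegral_heatMeasure (t : ℝ) {N : EuclideanSpace ℝ (Fin n) → ℝ≥0∞} (hN : Measurable N) :
    ∫⁻ w, N w ∂heatMeasure n t = ∫⁻ w, ENNReal.ofReal (heatKernel t w) * N w :=
  lintegral_withDensity_eq_lintegral_mul _ (measurable_heatKernel t).ennreal_ofReal hN

lemma lintegral_homogeneous_heatMeasure_le (hn : 1 ≤ n)
    {N : EuclideanSpace ℝ (Fin n) → ℝ≥0∞} (hN : Measurable N)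
    (hhom : ∀ (r : ℝ) w, N (r • w) = ‖r‖ₑ * N w) :
    ∫⁻ w, N w ∂heatMeasure n 1 ≤ 13 * ENNReal.ofReal √(n : ℝ) *
      ⨍⁻ σ : Metric.sphere (0 : EuclideanSpace ℝ (Fin n)) 1, N σ.1
        ∂(volume : Measure (EuclideanSpace ℝ (Fin n))).toSphere := by
  have h := lintegral_radial_mul_homogeneous hn (F := fun r => ENNReal.ofReal
    (1 / (4 * Real.pi * 1) ^ ((n : ℝ) / 2) * Real.exp (-r ^ 2 / (4 * 1)))) (by fun_prop) hN hhom
  have h2 := lintegral_heatMeasure (n := n) 1 (N := fun w => ‖w‖ₑ) (by fun_prop)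
  unfold heatKernel at h2
  rw [lintegral_heatMeasure 1 hN]
  unfold heatKernel
  rw [h, ← h2]
  gcongr
  exact lintegral_enorm_heatMeasure_le

end Polar

end HeatLPS

theorem theorem1p13 :
    ∃ c : ℝ≥0, 0 < c ∧
      ∀ (q : ℝ) (n : ℕ) (Y : Type*) [NormedAddCommGroup Y] [NormedSpace ℝ Y] [CompleteSpace Y],
        2 ≤ q → 1 ≤ n → HeatLPS.HasPowerTypeRenorming q Y →
        (∀ f : Fin n → EuclideanSpace ℝ (Fin n) → Y,
          (∀ j, MemLp (f j) (ENNReal.ofReal q) volume) →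
          (∀ t : ℝ, 0 < t → ∀ j, Differentiable ℝ (HeatLPS.heat t (f j))) ∧
          (∫⁻ t in Set.Ioi (0 : ℝ),
              eLpNorm (fun x => √t • HeatLPS.divergence (fun j => HeatLPS.heat t (f j)) x)
                (ENNReal.ofReal q) volume ^ q / ENNReal.ofReal t) ^ (1 / q)
            ≤ c * ENNReal.ofReal √(n : ℝ) * HeatLPS.martingaleCotypeConst q Y *
              ⨍⁻ σ : Metric.sphere (0 : EuclideanSpace ℝ (Fin n)) 1,
                eLpNorm (fun x => ∑ j, σ.1 j • f j x) (ENNReal.ofReal q) volume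
                ∂(volume : Measure (EuclideanSpace ℝ (Fin n))).toSphere) ∧
        (∀ (f : EuclideanSpace ℝ (Fin n) → Y) (z : EuclideanSpace ℝ (Fin n)),
          MemLp f (ENNReal.ofReal q) volume →
          (∀ t : ℝ, 0 < t → Differentiable ℝ (HeatLPS.heat t f)) ∧
          (∫⁻ t in Set.Ioi (0 : ℝ),
              eLpNorm (fun x => √t • lineDeriv ℝ (HeatLPS.heat t f) x z)
                (ENNReal.ofReal q) volume ^ q / ENNReal.ofReal t) ^ (1 / q)
            ≤ c * ‖z‖ₑ * HeatLPS.martingaleCotypeConst q Y *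
              eLpNorm f (ENNReal.ofReal q) volume) := by
  -- `39 = 3 * 13`: the bound 3 for the geometric sum times the 13 from the mean of `‖w‖`. The
  -- directional estimate would need only `3 * 7`.
  refine ⟨39, by norm_num, fun q n Y _ _ _ hq hn _ => ⟨fun f hf => ⟨fun t ht j => ?_, ?_⟩,
    fun f z hf => ⟨fun t ht => ?_, ?_⟩⟩⟩
  · exact HeatLPS.differentiable_heat (by simp; linarith) ht (hf j)
  · have hq1 : 1 < q := by linarith
    set v : Fin n → EuclideanSpace ℝ (Fin n) := fun j => EuclideanSpace.single j 1 with hv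
    refine (HeatLPS.lintegral_sqrt_smul_heatDeriv_le hq1 v hf).trans ?_
    have hcomb : ∀ w, HeatLPS.innerComb v f w = fun x => ∑ j, w j • f j x := by
      intro w
      ext x
      simp [HeatLPS.innerComb, hv, EuclideanSpace.inner_single_right]
    have h := HeatLPS.lintegral_homogeneous_heatMeasure_le hn
      (HeatLPS.measurable_eLpNorm_innerComb (one_pos.trans hq1) v fun j => (hf j).1)
      (HeatLPS.eLpNorm_innerComb_smul v f (ENNReal.ofReal q))
    refine (mul_le_mul_right h _).trans_eq ?_
    simp only [hcomb]
    rw [show ((39 : ℝ≥0) : ℝ≥0∞) = 3 * 13 by norm_num]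
    ring
  · exact HeatLPS.differentiable_heat (by simp; linarith) ht hf
  · have hq1 : 1 < q := by linarith
    have h := HeatLPS.lintegral_sqrt_smul_heatDeriv_le hq1 (fun _ : Unit => z) (f := fun _ => f)
      fun _ => hf
    have hD : ∀ t x, HeatLPS.heatDeriv (fun _ : Unit => z) (fun _ => f) t x
        = lineDeriv ℝ (HeatLPS.heat t f) x z := fun t x => by simp [HeatLPS.heatDeriv]
    have hcomb : ∀ w, eLpNorm (HeatLPS.innerComb (fun _ : Unit => z) (fun _ => f) w)
        (ENNReal.ofReal q) volume
        = ‖(inner ℝ w z : ℝ)‖ₑ * eLpNorm f (ENNReal.ofReal q) volume := fun w => by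
      rw [← eLpNorm_const_smul]
      congr 1
      ext x
      simp [HeatLPS.innerComb]
    simp only [hD, hcomb] at h
    rw [lintegral_mul_const _ (by fun_prop)] at h
    refine h.trans ?_
    calc 3 * HeatLPS.martingaleCotypeConst q Y *
          ((∫⁻ w, ‖(inner ℝ w z : ℝ)‖ₑ ∂HeatLPS.heatMeasure n 1)
            * eLpNorm f (ENNReal.ofReal q) volume)
        ≤ 3 * HeatLPS.martingaleCotypeConst q Y *
          ((13 * ‖z‖ₑ) * eLpNorm f (ENNReal.ofReal q) volume) := by
          gcongr
          refine (HeatLPS.lintegral_enorm_inner_heatMeasure_le z).trans ?_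
          gcongr
          norm_num
      _ = _ := by
          rw [show ((39 : ℝ≥0) : ℝ≥0∞) = 3 * 13 by norm_num]
          ring
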